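/- **Proposition (irrotational homogeneous Euler flows).** Let $\alpha\in\mathbb R$, let $v$ be a $C^1$ tangent vector field on the unit sphere $\mathbb S^2\subset\mathbb R^3$ and let $f,p\in C^1(\mathbb S^2)$ be real functions such that the fields $$V(x)=\frac{v(x/|x|)+f(x/|x|)\,x/|x|}{|x|^{\alpha}},\qquad P(x)=\frac{p(x/|x|)}{|x|^{2\alpha}}$$ solve the stationary Euler system $V\cdot\nabla V+\nabla P=0$, $\operatorname{div}V=0$ classically in $\mathbb R^3\setminus\{0\}$. Assume that $V$ is not identically zero and that the vorticity $\Omega=\nabla\times V$ vanishes in $\mathbb R^3\setminus\{0\}$. Then $\alpha\in\mathbb Z\setminus\{1\}$ and, with $\nabla f$ the gradient on the sphere, $$(1-\alpha)v=\nabla f,\qquad p=-\tfrac12 f^2-\tfrac1{2(1-\alpha)^2}|\nabla f|^2+c,$$ where $c$ is a real constant, with $c=0$ if $\alpha\neq0$ (for $\alpha=0$ the pressure is determined only up to an additive constant). The Bernoulli function $H=|v|^2+f^2+2p$ is identically equal to $2c$; in particular $H=0$ if $\alpha\ne0$. Moreover $f$ is a spherical harmonic of degree $l$, where $l=1-\alpha$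 if $\alpha\le0$ and $l=\alpha-2$ if $\alpha\ge2$: it is a real linear combination of the real spherical harmonics $Y_l^m$, $-l\le m\le l$. -/

import Mathlib

open scoped Manifold ContDiff Nat

noncomputable section

/-- Euclidean three-space. -/
abbrev E3 : Type := EuclideanSpace ℝ (Fin 3)

/-- The unit sphere `S²` in `ℝ³`, with Mathlib's smooth manifold structure. -/
abbrev S2 : Type := Metric.sphere (0 : E3) 1

/-- The point `x / |x|` of the unit sphere, for `x ≠ 0`. -/
def unitDir (x : E3) (hx : x ≠ 0) : S2 :=
  ⟨‖x‖⁻¹ • x, by simp [norm_smul, hx]⟩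

open Classical in
/-- The homogeneous extension `x ↦ g (x / |x|) / |x| ^ β` to `ℝ³ \ {0}` of a map `g` on the
sphere (the value at the origin is irrelevant and set to be zero). -/
def homExt {F : Type*} [AddCommGroup F] [Module ℝ F] (β : ℝ) (g : S2 → F) (x : E3) : F :=
  if hx : x = 0 then 0 else (‖x‖ ^ (-β)) • g (unitDir x hx)

/-- The velocity field `V(x) = (v + f n) / |x| ^ α`, where `n` is the outward unit normal of the
sphere. -/
def velocity (α : ℝ) (v : S2 → E3) (f : S2 → ℝ) : E3 → E3 :=
  homExt α (fun s => v s + f s • (s : E3))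

/-- The pressure `P(x) = p / |x| ^ (2 α)`. -/
def pressure (α : ℝ) (p : S2 → ℝ) : E3 → ℝ :=
  homExt (2 * α) p

/-- The partial derivative `∂ⱼ Vᵢ` at `x`. -/
def pderivComp (V : E3 → E3) (j i : Fin 3) (x : E3) : ℝ :=
  fderiv ℝ V x (EuclideanSpace.single j 1) i

/-- The divergence of a vector field in `ℝ³`. -/
def divergence (V : E3 → E3) (x : E3) : ℝ :=
  ∑ i, pderivComp V i i x

/-- The vorticity `∇ × V` of a vector field in `ℝ³`. -/
def curl (V : E3 → E3) (x : E3) : E3 :=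
  !₂[pderivComp V 1 2 x - pderivComp V 2 1 x,
     pderivComp V 2 0 x - pderivComp V 0 2 x,
     pderivComp V 0 1 x - pderivComp V 1 0 x]

/-- `(v, f, p)` is the spherical data of a classical `C¹` solution, homogeneous of degree `-α`,
of the stationary Euler system `V · ∇V + ∇P = 0`, `div V = 0` in `ℝ³ \ {0}`. -/
structure IsHomogeneousEulerSolution (α : ℝ) (v : S2 → E3) (f p : S2 → ℝ) : Prop where
  tangent : ∀ s : S2, inner ℝ (v s) (s : E3) = 0
  contMDiff_v : ContMDiff (𝓡 2) 𝓘(ℝ, E3) 1 v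
  contMDiff_f : ContMDiff (𝓡 2) 𝓘(ℝ, ℝ) 1 f
  contMDiff_p : ContMDiff (𝓡 2) 𝓘(ℝ, ℝ) 1 p
  momentum : ∀ x : E3, x ≠ 0 →
    fderiv ℝ (velocity α v f) x (velocity α v f x) + gradient (pressure α p) x = 0
  incompressible : ∀ x : E3, x ≠ 0 → divergence (velocity α v f) x = 0

/-- The gradient on the sphere, as a tangent vector in `ℝ³`: the Euclidean gradient of the
extension of `f` that is constant along rays. -/
def sphereGradient (f : S2 → ℝ) (s : S2) : E3 :=
  gradient (homExt 0 f) (s : E3)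

/-- The Bernoulli function `H = |v|² + f² + 2 p` on the sphere. -/
def bernoulliFn (v : S2 → E3) (f p : S2 → ℝ) (s : S2) : ℝ :=
  ‖v s‖ ^ 2 + f s ^ 2 + 2 * p s

/-- The Legendre polynomial of degree `l`, by Rodrigues' formula. -/
def legendrePoly (l : ℕ) : Polynomial ℝ :=
  Polynomial.C (1 / (2 ^ l * (l ! : ℝ))) *
    (Polynomial.derivative^[l] ((Polynomial.X ^ 2 - 1) ^ l))

/-- The azimuthal factor of the real spherical harmonics. At the point with spherical coordinates
`(φ, θ)` (`φ` the angle with the third axis) one has `x + i y = sin φ * exp (i θ)`, so that this is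
`√2 sin^m φ cos (m θ)` for `m > 0`, `1` for `m = 0`, and
`√2 sin^|m| φ sin (|m| θ)` for `m < 0`. -/
def azimuthal (m : ℤ) (s : S2) : ℝ :=
  if m = 0 then 1
  else if 0 < m then
    √2 * ((⟨(s : E3) 0, (s : E3) 1⟩ : ℂ) ^ m.natAbs).re
  else
    √2 * ((⟨(s : E3) 0, (s : E3) 1⟩ : ℂ) ^ m.natAbs).im

/-- The real, `L²`-normalized spherical harmonic `Y_l^m` of degree `l` and order `m`, where
`-l ≤ m ≤ l`. -/
def sphericalHarmonic (l : ℕ) (m : ℤ) (s : S2) : ℝ :=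
  √((2 * l + 1) / (4 * Real.pi) * (((l - m.natAbs)! : ℝ) / ((l + m.natAbs)! : ℝ))) *
    (Polynomial.derivative^[m.natAbs] (legendrePoly l)).eval ((s : E3) 2) * azimuthal m s

end

/-! Put φ(x) = V(x)·x, which restricts to f on the sphere and is homogeneous of degree β = 1 - α.
Vanishing vorticity makes the Jacobian DV symmetric, so Euler's relation gives ∇φ = V + (DV)x = (1 -
α)V. Its tangential part is (1 - α)v = ∇f, and div V = 0 makes φ harmonic away from the origin.
Symmetry also turns V·∇V into ∇|V|²/2, so |V|² + 2P is constant; being homogeneous of degree -2α, it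
vanishes unless α = 0. This gives the Bernoulli function and the pressure.

It remains to classify homogeneous harmonic functions
(`WeaklyHarmonic.exists_eq_sum_sphericalHarmonic`). With the rotation fields R_k, testing the weak
Laplace equation against a radial cutoff times Y_l^m yields (β(β+1) - l(l+1)) ∫ φ Y_l^m = 0 over the
sphere. Spherical harmonics of different degrees are orthogonal, and all of them together span a
dense subspace by Stone–Weierstrass. Hence a nonzero φ restricts to a single degree l with β(β+1) =
l(l+1), that is, α = 1 - l or α = l + 2.

The value α = 1 needs its own argument, since then ∇φ = 0 carries no information on V. The Cartesian
components of V are themselves weakly harmonic, of degree -1, hence constant on the sphere; so V =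
C/|x|, which is divergence-free only if C = 0. As V is merely C¹, harmonicity is used in weak form
throughout, with test functions supported away from the origin. -/

open MeasureTheory

/-! ### Test functions and the divergence theorem away from the origin -/

/-- A `C^n` function with compact support in `ℝ³ \ {0}`. -/
structure IsTestFunction (n : ℕ∞ω) (η : E3 → ℝ) : Prop where
  contDiff : ContDiff ℝ n η
  hasCompactSupport : HasCompactSupport η
  zero_notMem : (0 : E3) ∉ tsupport η

namespace IsTestFunction

variable {n : ℕ∞ω} {η : E3 → ℝ}

theorem ne_zero_of_mem (h : IsTestFunction n η) {x : E3} (hx : x ∈ tsupport η) : x ≠ 0 := by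
  rintro rfl; exact h.zero_notMem hx

/-- Off its support a function is locally zero, so regularity matters only at points of the support,
none of which is the origin. Factors singular at the origin are therefore allowed. -/
theorem of_tsupport_subset (h : IsTestFunction n η) {m : ℕ∞ω} {g : E3 → ℝ}
    (hg : ∀ x ∈ tsupport g, ContDiffAt ℝ m g x) (hs : tsupport g ⊆ tsupport η) :
    IsTestFunction m g where
  contDiff := by
    refine contDiff_iff_contDiffAt.2 fun x => ?_
    by_cases hx : x ∈ tsupport g
    · exact hg x hx
    · exact contDiffAt_const.congr_of_eventuallyEq (notMem_tsupport_iff_eventuallyEq.1 hx)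
  hasCompactSupport := h.hasCompactSupport.of_isClosed_subset (isClosed_tsupport g) hs
  zero_notMem hx := h.zero_notMem (hs hx)

theorem mul (h : IsTestFunction n η) {a : E3 → ℝ} (ha : ∀ x, x ≠ 0 → ContDiffAt ℝ n a x) :
    IsTestFunction n (fun x => a x * η x) := by
  have hs : tsupport (fun x => a x * η x) ⊆ tsupport η := tsupport_mul_subset_right
  exact h.of_tsupport_subset
    (fun x hx => (ha x (h.ne_zero_of_mem (hs hx))).mul h.contDiff.contDiffAt) hs

theorem mono (h : IsTestFunction n η) {m : ℕ∞ω} (hm : m ≤ n) : IsTestFunction m η :=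
  ⟨h.contDiff.of_le hm, h.2, h.3⟩

theorem fderiv_apply (h : IsTestFunction ∞ η) {Y : E3 → E3} (hY : ContDiff ℝ ∞ Y) :
    IsTestFunction ∞ (fun x => fderiv ℝ η x (Y x)) := by
  refine h.of_tsupport_subset (fun x _ => ?_) ?_
  · exact ((h.contDiff.fderiv_right (m := ∞) (by simp)).clm_apply hY).contDiffAt
  · refine closure_minimal (fun x hx => support_fderiv_subset ℝ (f := η) ?_) (isClosed_tsupport η)
    simp only [Function.mem_support] at hx ⊢
    intro h0; exact hx (by simp [h0])

theorem fderiv_eq_zero {x : E3} (hx : x ∉ tsupport η) : fderiv ℝ η x = 0 := by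
  by_contra h
  exact hx (support_fderiv_subset ℝ h)

theorem integrable_mul (h : IsTestFunction n η) {a : E3 → ℝ}
    (ha : ∀ x, x ≠ 0 → ContinuousAt a x) : Integrable (fun x => a x * η x) := by
  refine Continuous.integrable_of_hasCompactSupport ?_ h.hasCompactSupport.mul_left
  refine continuous_iff_continuousAt.2 fun x => ?_
  by_cases hx : x ∈ tsupport η
  · exact (ha x (h.ne_zero_of_mem hx)).mul h.contDiff.continuous.continuousAt
  · have : (fun x => a x * η x) =ᶠ[nhds x] fun _ => 0 := by
      filter_upwards [notMem_tsupport_iff_eventuallyEq.1 hx] with y hy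
      simp [hy]
    exact continuousAt_const.congr this.symm

theorem integrable_fderiv_apply (h : IsTestFunction 1 η) {Y : E3 → E3}
    (hY : ∀ x, x ≠ 0 → ContinuousAt Y x) : Integrable (fun x => fderiv ℝ η x (Y x)) := by
  have hs : HasCompactSupport (fun x => fderiv ℝ η x (Y x)) :=
    (h.hasCompactSupport.fderiv ℝ).mono fun x hx h0 => hx (by simp [h0])
  refine Continuous.integrable_of_hasCompactSupport ?_ hs
  refine continuous_iff_continuousAt.2 fun x => ?_
  by_cases hx : x ∈ tsupport η
  · exact ((h.contDiff.continuous_fderiv (by simp)).continuousAt).clm_apply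
      (hY x (h.ne_zero_of_mem hx))
  · have : (fun x => fderiv ℝ η x (Y x)) =ᶠ[nhds x] fun _ => 0 := by
      filter_upwards [(isClosed_tsupport η).isOpen_compl.mem_nhds hx] with y hy
      simp [fderiv_eq_zero hy]
    exact continuousAt_const.congr this.symm

end IsTestFunction

theorem integral_fderiv_apply_const {g : E3 → ℝ} (hg : ContDiff ℝ 1 g)
    (hc : HasCompactSupport g) (v : E3) : ∫ x, fderiv ℝ g x v = 0 := by
  have hi : Integrable (fun x => fderiv ℝ g x v) :=
    ((hg.continuous_fderiv (by simp)).clm_apply continuous_const).integrable_of_hasCompactSupport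
      ((hc.fderiv ℝ).mono fun x hx h0 => hx (by simp [h0]))
  -- Integration by parts against the constant 1, whose derivative vanishes.
  have := integral_mul_fderiv_eq_neg_fderiv_mul_of_integrable (μ := (volume : Measure E3))
    (f := fun _ => (1 : ℝ)) (g := g) (v := v) (by simp) (by simpa using hi)
    (by simpa using hg.continuous.integrable_of_hasCompactSupport hc)
    (by simp) (fun x _ => (hg.differentiable (by simp)) x)
  simpa using this

theorem sum_smul_single (y : E3) : ∑ i, y i • EuclideanSpace.single i (1 : ℝ) = y := by
  ext j; fin_cases j <;> simp [Fin.sum_univ_three]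

theorem clm_apply_eq_sum {F : Type*} [NormedAddCommGroup F] [NormedSpace ℝ F] (a : E3 →L[ℝ] F)
    (y : E3) : a y = ∑ i, y i • a (EuclideanSpace.single i (1 : ℝ)) := by
  conv_lhs => rw [← sum_smul_single y]
  simp

/-- The divergence theorem for a test function times a vector field. -/
theorem integral_fderiv_add_mul_divergence {η : E3 → ℝ} (h : IsTestFunction 1 η) {Y : E3 → E3}
    (hY : ∀ x, x ≠ 0 → ContDiffAt ℝ 1 Y x) :
    ∫ x, (fderiv ℝ η x (Y x) + η x * divergence Y x) = 0 := by
  have hYi : ∀ (i : Fin 3) x, x ≠ 0 → ContDiffAt ℝ 1 (fun x => Y x i) x := fun i x hx =>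
    (contDiffAt_piLp_apply 2).comp x (hY x hx)
  have ht : ∀ i : Fin 3, IsTestFunction 1 (fun x => Y x i * η x) := fun i => h.mul (hYi i)
  have hz : ∀ i : Fin 3,
      ∫ x, fderiv ℝ (fun x => Y x i * η x) x (EuclideanSpace.single i 1) = 0 := fun i =>
    integral_fderiv_apply_const (ht i).contDiff (ht i).hasCompactSupport _
  have hs : ∑ i : Fin 3,
      ∫ x, fderiv ℝ (fun x => Y x i * η x) x (EuclideanSpace.single i 1) = 0 := by simp [hz]
  rw [← integral_finsetSum _ fun i _ =>
    (ht i).integrable_fderiv_apply fun x _ => continuousAt_const] at hs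
  rw [← hs]
  congr 1
  ext x
  by_cases hx : x ∈ tsupport η
  · have hx0 := h.ne_zero_of_mem hx
    have hd : ∀ i : Fin 3, fderiv ℝ (fun x => Y x i * η x) x (EuclideanSpace.single i 1) =
        Y x i * fderiv ℝ η x (EuclideanSpace.single i 1) + η x * pderivComp Y i i x := by
      intro i
      have h1 : HasFDerivAt (fun x => Y x i) ((EuclideanSpace.proj i : E3 →L[ℝ] ℝ).comp
          (fderiv ℝ Y x)) x :=
        (EuclideanSpace.proj i : E3 →L[ℝ] ℝ).hasFDerivAt.comp x
          ((hY x hx0).differentiableAt (by simp)).hasFDerivAt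
      have h2 := (h.contDiff.differentiable (by simp) x).hasFDerivAt
      rw [(h1.fun_mul h2).fderiv]
      simp [pderivComp]
    simp only [hd, Finset.sum_add_distrib, ← Finset.mul_sum, divergence]
    rw [clm_apply_eq_sum (fderiv ℝ η x) (Y x)]
    simp
  · have h0 := notMem_tsupport_iff_eventuallyEq.1 hx
    have h2 : ∀ i : Fin 3, fderiv ℝ (fun x => Y x i * η x) x = 0 := fun i =>
      IsTestFunction.fderiv_eq_zero fun h' => hx (tsupport_mul_subset_right h')
    simp [IsTestFunction.fderiv_eq_zero hx, h2, h0.self_of_nhds]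

/-! ### Rotation fields and the weak Laplace equation -/

/-- The infinitesimal rotation `x ↦ eₖ × x`. -/
noncomputable def rot (k : Fin 3) : E3 →L[ℝ] E3 :=
  LinearMap.toContinuousLinearMap
    { toFun := fun x => (![!₂[0, -x 2, x 1], !₂[x 2, 0, -x 0], !₂[-x 1, x 0, 0]] : Fin 3 → E3) k
      map_add' := fun x y => by
        fin_cases k <;> ext i <;> fin_cases i <;> simp [add_comm]
      map_smul' := fun c x => by
        fin_cases k <;> ext i <;> fin_cases i <;> simp }

theorem rot_zero (x : E3) : rot 0 x = !₂[0, -x 2, x 1] := rfl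
theorem rot_one (x : E3) : rot 1 x = !₂[x 2, 0, -x 0] := rfl
theorem rot_two (x : E3) : rot 2 x = !₂[-x 1, x 0, 0] := rfl

theorem inner_rot_right (k : Fin 3) (x : E3) : inner ℝ x (rot k x) = 0 := by
  fin_cases k <;> simp [rot_zero, rot_one, rot_two, PiLp.inner_apply, Fin.sum_univ_three] <;> ring

theorem divergence_rot (k : Fin 3) (x : E3) : divergence (rot k) x = 0 := by
  fin_cases k <;>
    simp [divergence, pderivComp, rot_zero, rot_one, rot_two, Fin.sum_univ_three]

theorem divergence_id (x : E3) : divergence (fun y => y) x = 3 := by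
  simp [divergence, pderivComp]

/-- The derivative in the direction of the infinitesimal rotation around the `k`-th axis. -/
noncomputable def angDeriv (k : Fin 3) (η : E3 → ℝ) (x : E3) : ℝ :=
  fderiv ℝ η x (rot k x)

/-- A weak solution of the Laplace equation in `ℝ³ \ {0}`. -/
def WeaklyHarmonic (u : E3 → ℝ) : Prop :=
  ∀ η : E3 → ℝ, IsTestFunction ∞ η →
    ∫ x, ∑ j, fderiv ℝ u x (EuclideanSpace.single j 1) *
      fderiv ℝ η x (EuclideanSpace.single j 1) = 0

theorem IsTestFunction.angDeriv {η : E3 → ℝ} (h : IsTestFunction ∞ η) (k : Fin 3) :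
    IsTestFunction ∞ (angDeriv k η) :=
  h.fderiv_apply (rot k).contDiff

/-- Lagrange's identity |x|²(a·b) = (x × a)·(x × b) + (x·a)(x·b), since a applied to eₖ × x is the
k-th component of x × a. It splits the Dirichlet form into rotational and radial parts. -/
theorem lagrange_identity (a b : E3 →L[ℝ] ℝ) (x : E3) :
    ‖x‖ ^ 2 * ∑ j, a (EuclideanSpace.single j 1) * b (EuclideanSpace.single j 1) =
      ∑ k, a (rot k x) * b (rot k x) + a x * b x := by
  simp only [EuclideanSpace.real_norm_sq_eq, Fin.sum_univ_three]
  rw [clm_apply_eq_sum a x, clm_apply_eq_sum b x]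
  rw [clm_apply_eq_sum a (rot 0 x), clm_apply_eq_sum b (rot 0 x), clm_apply_eq_sum a (rot 1 x),
    clm_apply_eq_sum b (rot 1 x), clm_apply_eq_sum a (rot 2 x), clm_apply_eq_sum b (rot 2 x)]
  simp [rot_zero, rot_one, rot_two, Fin.sum_univ_three]
  ring

theorem hasFDerivAt_inv_norm_sq {x : E3} (hx : x ≠ 0) :
    HasFDerivAt (fun y : E3 => (‖y‖ ^ 2)⁻¹) (-((‖x‖ ^ 2) ^ 2)⁻¹ • (2 • innerSL ℝ x)) x :=
  (hasDerivAt_inv (by positivity)).comp_hasFDerivAt x (hasStrictFDerivAt_norm_sq x).hasFDerivAt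

theorem contDiffAt_inv_norm_sq {x : E3} (hx : x ≠ 0) {n : ℕ∞ω} :
    ContDiffAt ℝ n (fun y : E3 => (‖y‖ ^ 2)⁻¹) x :=
  (contDiff_norm_sq ℝ).contDiffAt.inv (by positivity)

theorem ae_ne_zero : ∀ᵐ x : E3, x ≠ 0 := by
  simp [ae_iff]

theorem integral_fderiv_rot {g : E3 → ℝ} (hg : IsTestFunction 1 g) (k : Fin 3) :
    ∫ x, fderiv ℝ g x (rot k x) = 0 := by
  simpa [divergence_rot] using
    integral_fderiv_add_mul_divergence hg (Y := rot k) fun x _ => (rot k).contDiff.contDiffAt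

theorem integral_angDeriv_mul {w : E3 → ℝ} (hw : ∀ x, x ≠ 0 → ContDiffAt ℝ 1 w x)
    {η : E3 → ℝ} (hη : IsTestFunction 1 η) (k : Fin 3) :
    ∫ x, (angDeriv k w x * η x + w x * angDeriv k η x) = 0 := by
  rw [← integral_fderiv_rot (hη.mul hw) k]
  refine integral_congr_ae ?_
  filter_upwards [ae_ne_zero] with x hx
  rw [fderiv_fun_mul ((hw x hx).differentiableAt (by simp))
    (hη.contDiff.differentiable (by simp) x)]
  simp [angDeriv]; ring

/-- The equation satisfied on spheres by a weakly harmonic function homogeneous of degree `β`. -/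
theorem WeaklyHarmonic.integral_angDeriv {u : E3 → ℝ} (hW : WeaklyHarmonic u)
    (hu : ∀ x, x ≠ 0 → ContDiffAt ℝ 1 u x) {β : ℝ} (hE : ∀ x, x ≠ 0 → fderiv ℝ u x x = β * u x)
    {η : E3 → ℝ} (hη : IsTestFunction ∞ η) :
    ∫ x, (‖x‖ ^ 2)⁻¹ * u x *
      (∑ k, angDeriv k (angDeriv k η) x + β * (β + 1) * η x) = 0 := by
  set w : E3 → ℝ := fun x => (‖x‖ ^ 2)⁻¹ * u x with hwdef
  have hw : ∀ x, x ≠ 0 → ContDiffAt ℝ 1 w x := fun x hx =>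
    (contDiffAt_inv_norm_sq hx).mul (hu x hx)
  have hη1 : IsTestFunction 1 η := hη.mono (by simp)
  have hA : ∀ k, IsTestFunction 1 (fun x => w x * angDeriv k η x) := fun k =>
    ((hη.angDeriv k).mono (by simp)).mul hw
  have hB : IsTestFunction 1 (fun x => w x * η x) := hη1.mul hw
  have iA : ∀ k, Integrable (fun x => fderiv ℝ (fun x => w x * angDeriv k η x) x (rot k x)) :=
    fun k => (hA k).integrable_fderiv_apply fun x _ => (rot k).continuous.continuousAt
  have iB : Integrable (fun x => fderiv ℝ (fun x => w x * η x) x x + w x * η x * 3) :=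
    (hB.integrable_fderiv_apply (Y := fun x => x) fun x _ => continuousAt_id).add
      ((hB.contDiff.continuous.integrable_of_hasCompactSupport hB.hasCompactSupport).mul_const 3)
  have iC : Integrable (fun x => ∑ j, fderiv ℝ u x (EuclideanSpace.single j 1) *
      fderiv ℝ η x (EuclideanSpace.single j 1)) := by
    refine integrable_finsetSum _ fun j _ => ?_
    refine (hη.fderiv_apply (Y := fun _ => EuclideanSpace.single j 1)
      contDiff_const).integrable_mul fun x hx => ?_
    exact (((hu x hx).fderiv_right (m := 0) (by simp)).continuousAt).clm_apply continuousAt_const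
  have zB : ∫ x, (fderiv ℝ (fun x => w x * η x) x x + w x * η x * 3) = 0 := by
    simpa [divergence_id] using
      integral_fderiv_add_mul_divergence hB (Y := fun x => x) fun x _ => contDiffAt_id
  -- Three vanishing integrals: rotational derivatives, β times the divergence of w η x, and the
  -- weak equation. By `lagrange_identity` the products of first derivatives cancel pointwise,
  -- leaving the claimed integrand.
  have key : ∫ x, ((∑ k, fderiv ℝ (fun x => w x * angDeriv k η x) x (rot k x)) +
      β * (fderiv ℝ (fun x => w x * η x) x x + w x * η x * 3) -
      ∑ j, fderiv ℝ u x (EuclideanSpace.single j 1) *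
      fderiv ℝ η x (EuclideanSpace.single j 1)) = 0 := by
    rw [integral_sub _ iC, integral_add _ (iB.const_mul β), integral_finsetSum _ fun k _ => iA k,
      integral_const_mul, zB, hW η hη]
    · simp [integral_fderiv_rot (hA _)]
    · exact integrable_finsetSum _ fun k _ => iA k
    · exact (integrable_finsetSum _ fun k _ => iA k).add (iB.const_mul β)
  rw [← key]
  refine integral_congr_ae ?_
  filter_upwards [ae_ne_zero] with x hx
  have hn : ‖x‖ ^ 2 ≠ 0 := by positivity
  have hud := (hu x hx).differentiableAt (by simp)
  have hwd := (hw x hx).differentiableAt (by simp)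
  have hwf : ∀ y, fderiv ℝ w x y =
      (‖x‖ ^ 2)⁻¹ * fderiv ℝ u x y - 2 * ((‖x‖ ^ 2) ^ 2)⁻¹ * inner ℝ x y * u x := by
    intro y
    rw [((hasFDerivAt_inv_norm_sq hx).fun_mul hud.hasFDerivAt).fderiv]
    simp; ring
  have hL : ∑ j, fderiv ℝ u x (EuclideanSpace.single j 1) *
      fderiv ℝ η x (EuclideanSpace.single j 1) =
      (‖x‖ ^ 2)⁻¹ * (∑ k, fderiv ℝ u x (rot k x) * fderiv ℝ η x (rot k x) +
        fderiv ℝ u x x * fderiv ℝ η x x) := by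
    rw [← lagrange_identity, inv_mul_cancel_left₀ hn]
  have h1 : ∀ k, fderiv ℝ (fun x => w x * angDeriv k η x) x (rot k x) =
      (‖x‖ ^ 2)⁻¹ * (fderiv ℝ u x (rot k x) * fderiv ℝ η x (rot k x)) +
        w x * angDeriv k (angDeriv k η) x := by
    intro k
    rw [fderiv_fun_mul hwd ((hη.angDeriv k).contDiff.differentiable (by simp) x)]
    simp only [add_apply, smul_apply, smul_eq_mul, hwf,
      inner_rot_right]
    simp only [angDeriv]
    ring
  -- The weight w has degree β - 2; adding div x = 3 produces the factor β + 1.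
  have h2 : fderiv ℝ (fun x => w x * η x) x x =
      w x * fderiv ℝ η x x + (β - 2) * w x * η x := by
    rw [fderiv_fun_mul hwd (hη1.contDiff.differentiable (by simp) x)]
    simp only [add_apply, smul_apply, smul_eq_mul, hwf,
      real_inner_self_eq_norm_sq, hE x hx]
    simp only [hwdef]
    field_simp
  simp only [hL, h1, h2, hE x hx, Finset.sum_add_distrib, ← Finset.mul_sum]
  simp only [hwdef]
  ring

/-! ### Rotations acting on axial functions -/

/-- The complex coordinate `x₀ + i x₁`. -/
noncomputable def planar (x : E3) : ℂ := ⟨x 0, x 1⟩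

theorem planar_eq (x : E3) : planar x = (x 0 : ℂ) + Complex.I * (x 1 : ℂ) := by
  apply Complex.ext <;> simp [planar]

/-- The complex-valued function `q(x₂) (x₀ + i x₁) ^ m`. -/
noncomputable def axialFn (q : Polynomial ℝ) (m : ℕ) (x : E3) : ℂ :=
  ((q.eval (x 2) : ℝ) : ℂ) * planar x ^ m

theorem hasFDerivAt_coord (i : Fin 3) (x : E3) :
    HasFDerivAt (fun y : E3 => (y i : ℂ)) (Complex.ofRealCLM ∘L (EuclideanSpace.proj i)) x :=
  (Complex.ofRealCLM ∘L (EuclideanSpace.proj i : E3 →L[ℝ] ℝ)).hasFDerivAt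

theorem hasFDerivAt_planar_pow (n : ℕ) (x : E3) :
    HasFDerivAt (fun y => planar y ^ n) ((n * planar x ^ (n - 1) : ℂ) •
      ((Complex.ofRealCLM ∘L (EuclideanSpace.proj 0 : E3 →L[ℝ] ℝ)) +
        Complex.I • (Complex.ofRealCLM ∘L (EuclideanSpace.proj 1 : E3 →L[ℝ] ℝ)))) x := by
  have h : HasFDerivAt planar ((Complex.ofRealCLM ∘L (EuclideanSpace.proj 0 : E3 →L[ℝ] ℝ)) +
        Complex.I • (Complex.ofRealCLM ∘L (EuclideanSpace.proj 1 : E3 →L[ℝ] ℝ))) x := by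
    rw [funext planar_eq]
    exact (hasFDerivAt_coord 0 x).fun_add ((hasFDerivAt_coord 1 x).const_mul Complex.I)
  exact (hasDerivAt_pow n (planar x)).comp_hasFDerivAt x h

theorem hasFDerivAt_eval (q : Polynomial ℝ) (x : E3) :
    HasFDerivAt (fun y : E3 => ((q.eval (y 2) : ℝ) : ℂ)) (((q.derivative.eval (x 2) : ℝ) : ℂ) •
      (Complex.ofRealCLM ∘L (EuclideanSpace.proj 2 : E3 →L[ℝ] ℝ))) x := by
  have h1 := (q.hasDerivAt (x 2)).comp_hasFDerivAt x
    (EuclideanSpace.proj 2 : E3 →L[ℝ] ℝ).hasFDerivAt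
  have h2 := Complex.ofRealCLM.hasFDerivAt.comp x h1
  refine h2.congr_fderiv ?_
  ext y
  simp

/-- The complex-valued analogue of `angDeriv`. -/
noncomputable def angDerivC (k : Fin 3) (F : E3 → ℂ) (x : E3) : ℂ :=
  fderiv ℝ F x (rot k x)

theorem angDerivC_zero_axialFn (q : Polynomial ℝ) (m : ℕ) (x : E3) :
    angDerivC 0 (axialFn q m) x = ((q.derivative.eval (x 2) : ℝ) : ℂ) * (x 1) * planar x ^ m
      - Complex.I * ((q.eval (x 2) : ℝ) : ℂ) * (x 2) * (m * planar x ^ (m - 1)) := by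
  unfold angDerivC axialFn
  rw [((hasFDerivAt_eval q x).fun_mul (hasFDerivAt_planar_pow m x)).fderiv]
  simp [rot_zero]; ring

theorem angDerivC_one_axialFn (q : Polynomial ℝ) (m : ℕ) (x : E3) :
    angDerivC 1 (axialFn q m) x = -((q.derivative.eval (x 2) : ℝ) : ℂ) * (x 0) * planar x ^ m
      + ((q.eval (x 2) : ℝ) : ℂ) * (x 2) * (m * planar x ^ (m - 1)) := by
  unfold angDerivC axialFn
  rw [((hasFDerivAt_eval q x).fun_mul (hasFDerivAt_planar_pow m x)).fderiv]
  simp [rot_one]; ring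

theorem angDerivC_two_axialFn (q : Polynomial ℝ) (m : ℕ) (x : E3) :
    angDerivC 2 (axialFn q m) x = Complex.I * m * axialFn q m x := by
  unfold angDerivC axialFn
  rw [((hasFDerivAt_eval q x).fun_mul (hasFDerivAt_planar_pow m x)).fderiv]
  rcases m with _ | m
  · simp [rot_two]
  · simp [rot_two, planar_eq, pow_succ]
    linear_combination (-((q.eval (x 2) : ℝ) : ℂ) * (m + 1) *
      (x 0 + Complex.I * x 1) ^ m * x 1) * Complex.I_sq

theorem contDiff_axialFn (q : Polynomial ℝ) (m : ℕ) : ContDiff ℝ ∞ (axialFn q m) := by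
  have h0 : ∀ i : Fin 3, ContDiff ℝ ∞ (fun y : E3 => (y i : ℂ)) := fun i =>
    (Complex.ofRealCLM ∘L (EuclideanSpace.proj i : E3 →L[ℝ] ℝ)).contDiff
  have h1 : ContDiff ℝ ∞ planar := by
    rw [funext planar_eq]
    exact (h0 0).add (contDiff_const.mul (h0 1))
  have h2 : ContDiff ℝ ∞ (fun y : E3 => ((q.eval (y 2) : ℝ) : ℂ)) :=
    by
    simpa using! Complex.ofRealCLM.contDiff.comp
      ((q.contDiff_aeval ∞).comp (EuclideanSpace.proj 2 : E3 →L[ℝ] ℝ).contDiff)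
  exact h2.mul (h1.pow m)

/-- The third rotation multiplies by i m. In the squares of the other two, the m(m - 1) terms cancel
because i² = -1, and x₀² + x₁² = 1 - x₂² turns what is left into the associated Legendre operator.
-/
theorem sum_angDerivC_axialFn (q : Polynomial ℝ) (m : ℕ) (x : E3) (hx : ‖x‖ = 1) :
    ∑ k, angDerivC k (angDerivC k (axialFn q m)) x =
      ((((1 - Polynomial.X ^ 2) * q.derivative.derivative
        - 2 * ((m : Polynomial ℝ) + 1) * Polynomial.X * q.derivative
        - (m : Polynomial ℝ) * ((m : Polynomial ℝ) + 1) * q).eval (x 2) : ℝ) : ℂ) *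
        planar x ^ m := by
  have hs : (x 0 : ℂ) ^ 2 + x 1 ^ 2 + x 2 ^ 2 = 1 := by
    have := EuclideanSpace.real_norm_sq_eq x
    rw [hx, Fin.sum_univ_three] at this
    exact_mod_cast this.symm.trans (by norm_num)
  have h0 : angDerivC 0 (angDerivC 0 (axialFn q m)) x =
      ((q.derivative.derivative.eval (x 2) : ℝ) : ℂ) * x 1 ^ 2 * planar x ^ m
      - ((q.derivative.eval (x 2) : ℝ) : ℂ) * x 2 * planar x ^ m
      - 2 * Complex.I * ((q.derivative.eval (x 2) : ℝ) : ℂ) * x 1 * x 2 * (m * planar x ^ (m - 1))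
      - Complex.I * ((q.eval (x 2) : ℝ) : ℂ) * x 1 * (m * planar x ^ (m - 1))
      + Complex.I ^ 2 * ((q.eval (x 2) : ℝ) : ℂ) * x 2 ^ 2 *
        (m * ((m - 1 : ℕ) * planar x ^ (m - 1 - 1))) := by
    rw [funext (angDerivC_zero_axialFn q m), angDerivC]
    rw [(HasFDerivAt.fun_sub (((hasFDerivAt_eval q.derivative x).fun_mul
      (hasFDerivAt_coord 1 x)).fun_mul (hasFDerivAt_planar_pow m x))
      ((((hasFDerivAt_eval q x).const_mul Complex.I).fun_mul
      (hasFDerivAt_coord 2 x)).fun_mul ((hasFDerivAt_planar_pow (m - 1) x).const_mul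
        (m : ℂ)))).fderiv]
    simp [rot_zero]
    linear_combination (((q.eval (x 2) : ℝ) : ℂ) * x 2 ^ 2 *
        (m * ((m - 1 : ℕ) * planar x ^ (m - 1 - 1)))) * Complex.I_sq
  have h1 : angDerivC 1 (angDerivC 1 (axialFn q m)) x =
      ((q.derivative.derivative.eval (x 2) : ℝ) : ℂ) * x 0 ^ 2 * planar x ^ m
      - ((q.derivative.eval (x 2) : ℝ) : ℂ) * x 2 * planar x ^ m
      - 2 * ((q.derivative.eval (x 2) : ℝ) : ℂ) * x 0 * x 2 * (m * planar x ^ (m - 1))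
      - ((q.eval (x 2) : ℝ) : ℂ) * x 0 * (m * planar x ^ (m - 1))
      + ((q.eval (x 2) : ℝ) : ℂ) * x 2 ^ 2 *
        (m * ((m - 1 : ℕ) * planar x ^ (m - 1 - 1))) := by
    rw [funext (angDerivC_one_axialFn q m), angDerivC]
    rw [(HasFDerivAt.fun_add (((hasFDerivAt_eval q.derivative x).fun_neg.fun_mul
      (hasFDerivAt_coord 0 x)).fun_mul (hasFDerivAt_planar_pow m x))
      (((hasFDerivAt_eval q x).fun_mul
      (hasFDerivAt_coord 2 x)).fun_mul ((hasFDerivAt_planar_pow (m - 1) x).const_mul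
        (m : ℂ)))).fderiv]
    simp [rot_one]; ring
  have h2 : angDerivC 2 (angDerivC 2 (axialFn q m)) x = -(m : ℂ) ^ 2 * axialFn q m x := by
    rw [funext (angDerivC_two_axialFn q m), angDerivC, fderiv_const_mul
      ((contDiff_axialFn q m).differentiable (by simp) x)]
    change Complex.I * m * angDerivC 2 (axialFn q m) x = _
    rw [angDerivC_two_axialFn]
    linear_combination (m : ℂ) ^ 2 * axialFn q m x * Complex.I_sq
  have hz : planar x = (x 0 : ℂ) + Complex.I * (x 1 : ℂ) := planar_eq x
  rw [Fin.sum_univ_three, h0, h1, h2, axialFn, Complex.I_sq]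
  -- The factor m keeps this true at m = 0, where `m - 1` is truncated.
  have hp : (m : ℂ) * planar x ^ (m - 1) * planar x = m * planar x ^ m := by
    rcases m with _ | m
    · simp
    · simp [pow_succ]; ring
  simp only [Polynomial.eval_sub, Polynomial.eval_mul, Polynomial.eval_pow, Polynomial.eval_X,
    Polynomial.eval_one, Polynomial.eval_add, Polynomial.eval_natCast, Polynomial.eval_ofNat]
  push_cast
  rw [hz] at hp ⊢
  linear_combination
    (-2 * ((q.derivative.eval (x 2) : ℝ) : ℂ) * x 2 - ((q.eval (x 2) : ℝ) : ℂ)) * hp +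
    ((q.derivative.derivative.eval (x 2) : ℝ) : ℂ) * (x 0 + Complex.I * x 1) ^ m * hs

/-! ### The Legendre equation -/

-- The polynomial y = (X² - 1)^l satisfies (X² - 1)y' = 2lXy; this is its derivative of order n + 1.
open Polynomial in
theorem iterate_derivative_legendre_aux (l n : ℕ) :
    (X ^ 2 - 1 : ℝ[X]) * derivative^[n + 2] ((X ^ 2 - 1) ^ l)
      + (2 * ((n : ℝ[X]) + 1) - 2 * (l : ℝ[X])) * X * derivative^[n + 1] ((X ^ 2 - 1) ^ l)
      + (((n : ℝ[X]) + 1) * (n : ℝ[X]) - 2 * (l : ℝ[X]) * ((n : ℝ[X]) + 1)) *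
        derivative^[n] ((X ^ 2 - 1) ^ l) = 0 := by
  induction n with
  | zero =>
    have h : (X ^ 2 - 1 : ℝ[X]) * derivative ((X ^ 2 - 1) ^ l) =
        2 * (l : ℝ[X]) * X * (X ^ 2 - 1) ^ l := by
      rcases l with _ | l
      · simp
      · rw [derivative_pow]; simp [pow_succ]; ring
    have h' := congrArg derivative h
    simp only [derivative_mul, derivative_sub, derivative_X_pow, derivative_one, derivative_X,
      derivative_natCast, derivative_ofNat] at h'
    simp only [Function.iterate_succ, Function.iterate_zero, Function.comp, id]
    simp at h' ⊢
    rw [map_ofNat C 2] at h'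
    linear_combination h'
  | succ n ih =>
    have h' := congrArg derivative ih
    simp only [derivative_add, derivative_mul, derivative_sub, derivative_X_pow, derivative_one,
      derivative_X, derivative_natCast, derivative_ofNat, ← Function.iterate_succ_apply',
      derivative_zero] at h'
    simp at h' ⊢
    rw [map_ofNat C 2] at h'
    linear_combination h'

-- Take n = l + m in the previous identity: the last coefficient is (l + m + 1)(m - l) = m(m + 1) -
-- l(l + 1).
open Polynomial in
theorem legendre_ode (l m : ℕ) :
    (1 - X ^ 2) * derivative (derivative (derivative^[m] (legendrePoly l)))
        - 2 * ((m : ℝ[X]) + 1) * X * derivative (derivative^[m] (legendrePoly l))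
        - (m : ℝ[X]) * ((m : ℝ[X]) + 1) * derivative^[m] (legendrePoly l) =
      -((l : ℝ[X]) * ((l : ℝ[X]) + 1)) * derivative^[m] (legendrePoly l) := by
  have h := iterate_derivative_legendre_aux l (l + m)
  have hC : ∀ n, derivative^[n] (legendrePoly l) =
      C (1 / (2 ^ l * (l ! : ℝ))) * derivative^[l + n] ((X ^ 2 - 1) ^ l) := by
    intro n
    rw [legendrePoly, iterate_derivative_C_mul, ← Function.iterate_add_apply, add_comm]
  have hs : ∀ n, derivative (derivative^[n] (legendrePoly l)) =
      derivative^[n + 1] (legendrePoly l) := fun n => (Function.iterate_succ_apply' _ _ _).symm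
  rw [hs, hs, hC, hC, hC]
  push_cast at h
  simp only [← add_assoc] at h ⊢
  linear_combination -C (1 / (2 ^ l * (l ! : ℝ))) * h

/-! ### Radial cutoffs and eigenfunctions on the sphere -/

/-- The radial projection `x ↦ x / |x|`. -/
noncomputable def radialProj (x : E3) : E3 := ‖x‖⁻¹ • x

theorem norm_radialProj {x : E3} (hx : x ≠ 0) : ‖radialProj x‖ = 1 := by
  simp [radialProj, norm_smul, hx]

theorem hasFDerivAt_norm {x : E3} (hx : x ≠ 0) :
    HasFDerivAt (fun y : E3 => ‖y‖) (‖x‖⁻¹ • innerSL ℝ x) x := by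
  have h := (hasStrictFDerivAt_norm_sq x).hasFDerivAt.sqrt (by positivity)
  simp only [Real.sqrt_sq (norm_nonneg _)] at h
  refine h.congr_fderiv ?_
  ext y
  have : ‖x‖ ≠ 0 := by positivity
  simp
  field_simp

theorem contDiffAt_radialProj {x : E3} (hx : x ≠ 0) {n : ℕ∞ω} : ContDiffAt ℝ n radialProj x :=
  ((contDiffAt_norm ℝ hx).inv (by positivity)).smul contDiffAt_id

theorem fderiv_radialProj_rot {x : E3} (hx : x ≠ 0) (k : Fin 3) :
    fderiv ℝ radialProj x (rot k x) = rot k (radialProj x) := by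
  have h1 := (hasDerivAt_inv (norm_ne_zero_iff.2 hx)).comp_hasFDerivAt x (hasFDerivAt_norm hx)
  have h2 : HasFDerivAt radialProj _ x := h1.fun_smul (hasFDerivAt_id x)
  rw [h2.fderiv]
  simp [inner_rot_right, radialProj]

/-- Rotation fields annihilate the norm and commute with radial projection, so only the angular
factor is differentiated. -/
theorem angDeriv_radial_mul {χ : ℝ → ℝ} (hχ : Differentiable ℝ χ) {A : E3 → ℝ}
    (hA : Differentiable ℝ A) (k : Fin 3) {x : E3} (hx : x ≠ 0) :
    angDeriv k (fun y => χ ‖y‖ * A (radialProj y)) x = χ ‖x‖ * angDeriv k A (radialProj x) := by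
  have h1 := (hχ ‖x‖).hasDerivAt.comp_hasFDerivAt x (hasFDerivAt_norm hx)
  have h2 := (hA (radialProj x)).hasFDerivAt.comp x
    ((contDiffAt_radialProj hx (n := 1)).differentiableAt (by simp)).hasFDerivAt
  have h3 := h1.fun_mul h2
  simp only [Function.comp_def] at h3
  rw [angDeriv, h3.fderiv]
  simp [inner_rot_right, fderiv_radialProj_rot hx, angDeriv]

/-- A smooth cutoff function supported in the interval `[1, 3]`. -/
noncomputable def radialBump : ContDiffBump (2 : ℝ) := ⟨1 / 2, 1, by norm_num, by norm_num⟩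

theorem radialBump_eq_zero {r : ℝ} (hr : r ≤ 1 ∨ 3 ≤ r) : radialBump r = 0 := by
  refine radialBump.zero_of_le_dist ?_
  change (1 : ℝ) ≤ dist r 2
  rw [Real.dist_eq, le_abs]
  rcases hr with h | h
  · right; linarith
  · left; linarith

/-- The test function `χ(|x|) A(x / |x|)`. -/
noncomputable def radialTest (A : E3 → ℝ) (x : E3) : ℝ := radialBump ‖x‖ * A (radialProj x)

theorem isTestFunction_radialTest {A : E3 → ℝ} (hA : ContDiff ℝ ∞ A) :
    IsTestFunction ∞ (radialTest A) := by
  have hs : tsupport (radialTest A) ⊆ {x | 1 ≤ ‖x‖ ∧ ‖x‖ ≤ 3} := by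
    refine closure_minimal (fun x hx => ?_) ?_
    · by_contra h
      refine hx ?_
      rw [Set.mem_ofPred_eq, not_and_or, not_le, not_le] at h
      simp [radialTest, radialBump_eq_zero (h.imp le_of_lt le_of_lt)]
    · exact (isClosed_le continuous_const continuous_norm).inter
        (isClosed_le continuous_norm continuous_const)
  refine ⟨?_, ?_, fun h => ?_⟩
  · refine contDiff_iff_contDiffAt.2 fun x => ?_
    by_cases hx : x ∈ tsupport (radialTest A)
    · have hx0 : x ≠ 0 := by
        rintro rfl; have := (hs hx).1; norm_num at this
      exact (radialBump.contDiffAt.comp x (contDiffAt_norm ℝ hx0)).mul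
        (hA.contDiffAt.comp x (contDiffAt_radialProj hx0))
    · exact contDiffAt_const.congr_of_eventuallyEq (notMem_tsupport_iff_eventuallyEq.1 hx)
  · refine (isCompact_closedBall (0 : E3) 3).of_isClosed_subset (isClosed_tsupport _) fun x hx => ?_
    simpa using (hs hx).2
  · have := (hs h).1; norm_num at this

theorem angDeriv_radialTest {A : E3 → ℝ} (hA : ContDiff ℝ ∞ A) (k : Fin 3) :
    angDeriv k (radialTest A) = radialTest (angDeriv k A) := by
  ext x
  rcases eq_or_ne x 0 with rfl | hx
  · have h0 := IsTestFunction.fderiv_eq_zero (isTestFunction_radialTest hA).zero_notMem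
    rw [angDeriv, h0, radialTest, radialBump_eq_zero (by simp)]
    simp
  · exact angDeriv_radial_mul (radialBump.contDiff.differentiable (n := 1) (by simp))
      (hA.differentiable (by simp)) k hx

theorem contDiff_angDeriv {A : E3 → ℝ} (hA : ContDiff ℝ ∞ A) (k : Fin 3) :
    ContDiff ℝ ∞ (angDeriv k A) :=
  (hA.fderiv_right (m := ∞) (by simp)).clm_apply (rot k).contDiff

/-- A smooth function whose restriction to the unit sphere is an eigenfunction of the
Laplace–Beltrami operator, with eigenvalue `-μ`. -/
structure IsSphereEigenfunction (μ : ℝ) (A : E3 → ℝ) : Prop where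
  contDiff : ContDiff ℝ ∞ A
  eigen : ∀ x, ‖x‖ = 1 → ∑ k, angDeriv k (angDeriv k A) x = -μ * A x

theorem IsSphereEigenfunction.sum_angDeriv_radialTest {μ : ℝ} {A : E3 → ℝ}
    (h : IsSphereEigenfunction μ A) (x : E3) :
    ∑ k, angDeriv k (angDeriv k (radialTest A)) x = -μ * radialTest A x := by
  simp only [angDeriv_radialTest h.contDiff, angDeriv_radialTest (contDiff_angDeriv h.contDiff _)]
  rcases eq_or_ne x 0 with rfl | hx
  · simp [radialTest, radialBump_eq_zero]
  · simp only [radialTest, ← Finset.mul_sum, h.eigen _ (norm_radialProj hx)]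
    ring

/-- A real-linear L commutes with the rotation derivatives, so the cosine and sine cases are treated
at once; the eigenvalue comes from `legendre_ode`. -/
theorem isSphereEigenfunction_axialFn (l m : ℕ) (L : ℂ →L[ℝ] ℝ) :
    IsSphereEigenfunction (l * (l + 1))
      (fun x => L (axialFn (Polynomial.derivative^[m] (legendrePoly l)) m x)) := by
  have hL : ∀ (F : E3 → ℂ) (k : Fin 3), Differentiable ℝ F →
      angDeriv k (fun x => L (F x)) = fun x => L (angDerivC k F x) := by
    intro F k hF
    ext x
    have h := L.hasFDerivAt.comp x (hF x).hasFDerivAt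
    simp only [Function.comp_def] at h
    rw [angDeriv, h.fderiv]
    rfl
  have hc := contDiff_axialFn (Polynomial.derivative^[m] (legendrePoly l)) m
  refine ⟨L.contDiff.comp hc, fun x hx => ?_⟩
  have h1 : ∀ k, angDeriv k (angDeriv k (fun x => L (axialFn
      (Polynomial.derivative^[m] (legendrePoly l)) m x))) x =
      L (angDerivC k (angDerivC k (axialFn (Polynomial.derivative^[m] (legendrePoly l)) m)) x) := by
    intro k
    rw [hL _ k (hc.differentiable (by simp)), hL]
    exact ((hc.fderiv_right (m := ∞) (by simp)).clm_apply (rot k).contDiff).differentiable (by simp)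
  simp only [h1]
  rw [← map_sum, sum_angDerivC_axialFn _ _ _ hx, legendre_ode, axialFn]
  simp only [Polynomial.eval_neg, Polynomial.eval_mul, Polynomial.eval_add,
    Polynomial.eval_natCast, Polynomial.eval_one]
  rw [Complex.ofReal_mul, mul_assoc, ← Complex.real_smul, map_smul, smul_eq_mul]

theorem exists_sphericalHarmonic_eq (l : ℕ) (m : ℤ) :
    ∃ L : ℂ →L[ℝ] ℝ, ∀ s : S2, sphericalHarmonic l m s =
      L (axialFn (Polynomial.derivative^[m.natAbs] (legendrePoly l)) m.natAbs s) := by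
  refine ⟨(√((2 * l + 1) / (4 * Real.pi) * (((l - m.natAbs)! : ℝ) / ((l + m.natAbs)! : ℝ))) *
      if m = 0 then 1 else √2) • if 0 ≤ m then Complex.reCLM else Complex.imCLM, fun s => ?_⟩
  simp only [axialFn, sphericalHarmonic, azimuthal, planar]
  rcases lt_trichotomy m 0 with h | rfl | h
  · simp [h.ne, h.not_gt, h.not_ge]; ring
  · simp
  · simp [h.ne', h, h.le]; ring

theorem exists_eigenfunction_sphericalHarmonic (l : ℕ) (m : ℤ) :
    ∃ A : E3 → ℝ, IsSphereEigenfunction (l * (l + 1)) A ∧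
      ∀ s : S2, A s = sphericalHarmonic l m s := by
  obtain ⟨L, hL⟩ := exists_sphericalHarmonic_eq l m
  exact ⟨_, isSphereEigenfunction_axialFn l m.natAbs L, fun s => (hL s).symm⟩

/-! ### Integration in polar coordinates -/

/-- Polar coordinates carry Lebesgue measure off the origin, a null set, to a product measure; a
separated integrand then factors. -/
theorem integral_polar (w : ℝ → ℝ) (G : E3 → ℝ) :
    ∫ x : E3, w ‖x‖ * G (radialProj x) =
      (∫ s : S2, G s ∂(volume : Measure E3).toSphere) *
        ∫ r : Set.Ioi (0 : ℝ), w r ∂(Measure.volumeIoiPow (Module.finrank ℝ E3 - 1)) := by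
  have h := (volume : Measure E3).measurePreserving_homeomorphUnitSphereProd.integral_comp
    (Homeomorph.measurableEmbedding _) (fun z => G z.1 * w z.2)
  rw [integral_prod_mul (fun s : S2 => G s) (fun r : Set.Ioi (0 : ℝ) => w r)] at h
  rw [← h]
  have := integral_subtype_comap (μ := (volume : Measure E3)) (measurableSet_singleton 0).compl
    fun x : E3 => w ‖x‖ * G (radialProj x)
  rw [restrict_compl_singleton] at this
  rw [← this]
  refine integral_congr_ae (Filter.Eventually.of_forall fun x => ?_)
  simp [radialProj, mul_comm]

/-- By `integral_polar` with angular factor 1, this is a factor of the integral over ℝ³ of a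
nonnegative continuous function that is positive at a point of norm 2. -/
theorem integral_radialBump_ne_zero {w : ℝ → ℝ} (hw : ∀ r, 0 < r → ContDiffAt ℝ ∞ w r)
    (hw0 : ∀ r, 0 < r → 0 < w r) :
    (∫ r : Set.Ioi (0 : ℝ), w r * radialBump r
      ∂(Measure.volumeIoiPow (Module.finrank ℝ E3 - 1))) ≠ 0 := by
  intro h0
  have h := integral_polar (fun r => w r * radialBump r) (fun _ => 1)
  rw [h0, mul_zero] at h
  have ht : IsTestFunction ∞ (fun x => w ‖x‖ * radialTest (fun _ => 1) x) :=
    (isTestFunction_radialTest contDiff_const).mul fun x hx =>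
      (hw ‖x‖ (by positivity)).comp x (contDiffAt_norm ℝ hx)
  have hpos : 0 < ∫ x, w ‖x‖ * radialTest (fun _ => 1) x := by
    refine ht.contDiff.continuous.integral_pos_of_hasCompactSupport_nonneg_nonzero
      ht.hasCompactSupport (fun x => ?_) (x := EuclideanSpace.single 0 2) ?_
    · rcases eq_or_ne x 0 with rfl | hx
      · simp [radialTest, radialBump_eq_zero]
      · simpa [radialTest] using mul_nonneg (hw0 ‖x‖ (by positivity)).le radialBump.nonneg
    · have : radialBump (2 : ℝ) = 1 :=
        radialBump.one_of_mem_closedBall (by simp [radialBump])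
      simp [radialTest, this, (hw0 2 (by norm_num)).ne']
  refine hpos.ne' (Eq.trans ?_ h)
  simp [radialTest]

/-! ### Homogeneous functions and orthogonality on the sphere -/

theorem fderiv_apply_self_of_homogeneous {F : Type*} [NormedAddCommGroup F] [NormedSpace ℝ F]
    {u : E3 → F} {β : ℝ} {x : E3} (hu : DifferentiableAt ℝ u x)
    (hhom : ∀ t : ℝ, 0 < t → u (t • x) = t ^ β • u x) :
    fderiv ℝ u x x = β • u x := by
  have h1 : HasDerivAt (fun t : ℝ => u (t • x)) (fderiv ℝ u x x) 1 := by
    have hs : HasDerivAt (fun t : ℝ => t • x) x 1 := by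
      simpa using (hasDerivAt_id (1 : ℝ)).smul_const x
    have hu' : HasFDerivAt u (fderiv ℝ u x) ((1 : ℝ) • x) := by simpa using hu.hasFDerivAt
    exact hu'.comp_hasDerivAt (1 : ℝ) hs
  have h2 : HasDerivAt (fun t : ℝ => t ^ β • u x) (β • u x) 1 := by
    have := (Real.hasDerivAt_rpow_const (x := 1) (p := β) (Or.inl one_ne_zero)).smul_const (u x)
    simpa using this
  refine h1.unique (h2.congr_of_eventuallyEq ?_)
  filter_upwards [lt_mem_nhds (zero_lt_one' ℝ)] with t ht
  exact hhom t ht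

theorem homogeneous_eq_radialProj {F : Type*} [AddCommGroup F] [Module ℝ F]
    {u : E3 → F} {β : ℝ} (hhom : ∀ x, x ≠ 0 → ∀ t : ℝ, 0 < t → u (t • x) = t ^ β • u x) {x : E3}
    (hx : x ≠ 0) : u x = ‖x‖ ^ β • u (radialProj x) := by
  have hp : 0 < ‖x‖ := by positivity
  have hr : radialProj x ≠ 0 := by rw [← norm_ne_zero_iff, norm_radialProj hx]; norm_num
  rw [← hhom _ hr _ hp, radialProj, smul_smul, mul_inv_cancel₀ hp.ne', one_smul]

/-- A homogeneous weakly harmonic function is `L²(S²)`-orthogonal to the eigenfunctions of the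
Laplace–Beltrami operator with another eigenvalue. -/
theorem WeaklyHarmonic.integral_sphere_mul_eigenfunction {u : E3 → ℝ} (hW : WeaklyHarmonic u)
    (hu : ∀ x, x ≠ 0 → ContDiffAt ℝ 1 u x) {β : ℝ}
    (hhom : ∀ x, x ≠ 0 → ∀ t : ℝ, 0 < t → u (t • x) = t ^ β • u x)
    {μ : ℝ} {A : E3 → ℝ} (hA : IsSphereEigenfunction μ A) (hμ : β * (β + 1) ≠ μ) :
    ∫ s : S2, u s * A s ∂(volume : Measure E3).toSphere = 0 := by
  have h := hW.integral_angDeriv hu (β := β) (fun x hx =>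
    fderiv_apply_self_of_homogeneous ((hu x hx).differentiableAt (by simp)) (hhom x hx))
    (isTestFunction_radialTest hA.contDiff)
  have hp := integral_polar (fun r => (r ^ 2)⁻¹ * r ^ β * radialBump r) (fun x => u x * A x)
  -- For the test function χ(|x|)A(x/|x|) the operator acts as the scalar β(β + 1) - μ, and the
  -- remaining integrand separates in polar coordinates.
  have h2 : ∫ x : E3, (‖x‖ ^ 2)⁻¹ * u x * (∑ k, angDeriv k (angDeriv k (radialTest A)) x +
      β * (β + 1) * radialTest A x) = (β * (β + 1) - μ) *
      ∫ x : E3, (‖x‖ ^ 2)⁻¹ * ‖x‖ ^ β * radialBump ‖x‖ *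
        (u (radialProj x) * A (radialProj x)) := by
    rw [← integral_const_mul]
    refine integral_congr_ae ?_
    filter_upwards [ae_ne_zero] with x hx
    rw [hA.sum_angDeriv_radialTest, homogeneous_eq_radialProj hhom hx, radialTest, smul_eq_mul]
    ring
  rw [h2, hp] at h
  have hw := integral_radialBump_ne_zero (w := fun r => (r ^ 2)⁻¹ * r ^ β)
    (fun r hr => ((contDiffAt_id.pow 2).inv (by simp; positivity)).mul
      (contDiffAt_id.rpow_const_of_ne hr.ne')) (fun r hr => by positivity)
  rcases mul_eq_zero.1 h with h | h
  · exact absurd (sub_eq_zero.1 h) hμ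
  · exact (mul_eq_zero.1 h).resolve_right hw

/-- Each rotation derivative is skew-adjoint, so the sum of their squares is symmetric and distinct
eigenvalues give orthogonality. The integrals are taken over ℝ³ with a radial cutoff, whose nonzero
factor is divided out at the end. -/
theorem IsSphereEigenfunction.integral_mul_eq_zero {μ ν : ℝ} {A B : E3 → ℝ}
    (hA : IsSphereEigenfunction μ A) (hB : IsSphereEigenfunction ν B) (hμν : μ ≠ ν) :
    ∫ s : S2, A s * B s ∂(volume : Measure E3).toSphere = 0 := by
  have hproj : ∀ {F : E3 → ℝ}, ContDiff ℝ ∞ F → ∀ x, x ≠ 0 →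
      ContDiffAt ℝ 1 (fun x => F (radialProj x)) x := fun hF x hx =>
    (hF.of_le (by simp)).contDiffAt.comp x (contDiffAt_radialProj hx)
  have hang : ∀ {F : E3 → ℝ}, ContDiff ℝ ∞ F → ∀ k x, x ≠ 0 →
      angDeriv k (fun x => F (radialProj x)) x = angDeriv k F (radialProj x) := fun hF k x hx => by
    simpa using angDeriv_radial_mul (χ := fun _ => 1) (by fun_prop) (hF.differentiable (by simp))
      k hx
  have hcont : ∀ {F : E3 → ℝ}, ContDiff ℝ ∞ F → ∀ x, x ≠ 0 →
      ContinuousAt (fun x => F (radialProj x)) x := fun hF x hx => (hproj hF x hx).continuousAt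
  have hint : ∀ {F G : E3 → ℝ}, ContDiff ℝ ∞ F → ContDiff ℝ ∞ G →
      Integrable (fun x => F (radialProj x) * radialTest G x) := fun hF hG =>
    (isTestFunction_radialTest hG).integrable_mul (hcont hF)
  have hk : ∀ {F G : E3 → ℝ}, ContDiff ℝ ∞ F → ContDiff ℝ ∞ G → ∀ k,
      ∫ x, angDeriv k F (radialProj x) * radialTest G x =
        - ∫ x, F (radialProj x) * radialTest (angDeriv k G) x := by
    intro F G hF hG k
    rw [← add_eq_zero_iff_eq_neg, ← integral_add (hint (contDiff_angDeriv hF k) hG)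
      (hint hF (contDiff_angDeriv hG k)), ← integral_angDeriv_mul (hproj hF)
      ((isTestFunction_radialTest hG).mono (by simp)) k]
    refine integral_congr_ae ?_
    filter_upwards [ae_ne_zero] with x hx
    simp only [hang hF k x hx, angDeriv_radialTest hG]
  have hkk : ∀ k, ∫ x, angDeriv k (angDeriv k A) (radialProj x) * radialTest B x =
      ∫ x, A (radialProj x) * radialTest (angDeriv k (angDeriv k B)) x := fun k => by
    rw [hk (contDiff_angDeriv hA.contDiff k) hB.contDiff,
      hk hA.contDiff (contDiff_angDeriv hB.contDiff k), neg_neg]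
  have hsum := Finset.sum_congr (rfl : (Finset.univ : Finset (Fin 3)) = _) fun k _ => hkk k
  rw [← integral_finsetSum _ fun k _ => hint (contDiff_angDeriv
      (contDiff_angDeriv hA.contDiff k) k) hB.contDiff,
    ← integral_finsetSum _ fun k _ => hint hA.contDiff
      (contDiff_angDeriv (contDiff_angDeriv hB.contDiff k) k)] at hsum
  have hl : ∫ x, ∑ k, angDeriv k (angDeriv k A) (radialProj x) * radialTest B x =
      -μ * ∫ x, 1 * radialBump ‖x‖ * (A (radialProj x) * B (radialProj x)) := by
    rw [← integral_const_mul]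
    refine integral_congr_ae ?_
    filter_upwards [ae_ne_zero] with x hx
    rw [← Finset.sum_mul, hA.eigen _ (norm_radialProj hx), radialTest]
    ring
  have hr : ∫ x, ∑ k, A (radialProj x) * radialTest (angDeriv k (angDeriv k B)) x =
      -ν * ∫ x, 1 * radialBump ‖x‖ * (A (radialProj x) * B (radialProj x)) := by
    rw [← integral_const_mul]
    refine integral_congr_ae ?_
    filter_upwards [ae_ne_zero] with x hx
    simp only [radialTest]
    rw [← Finset.mul_sum, ← Finset.mul_sum, hB.eigen _ (norm_radialProj hx)]
    ring
  rw [hl, hr] at hsum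
  have hz : ∫ x : E3, 1 * radialBump ‖x‖ * (A (radialProj x) * B (radialProj x)) = 0 := by
    have : (μ - ν) * ∫ x : E3, 1 * radialBump ‖x‖ * (A (radialProj x) * B (radialProj x)) = 0 := by
      linarith
    exact (mul_eq_zero.1 this).resolve_left (sub_ne_zero.2 hμν)
  rw [integral_polar (fun r => 1 * radialBump r) (fun x => A x * B x)] at hz
  exact (mul_eq_zero.1 hz).resolve_right
    (integral_radialBump_ne_zero (w := fun _ => 1) (fun _ _ => contDiffAt_const) (by simp))

/-! ### Density of the spherical harmonics in C(S²) -/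

open Polynomial in
theorem degree_iterate_derivative_of_degree_eq {p : ℝ[X]} {n : ℕ} (k : ℕ)
    (hp : p.degree = (n + k : ℕ)) : (derivative^[k] p).degree = n := by
  induction k generalizing p with
  | zero => simpa using hp
  | succ k ih =>
    rw [Function.iterate_succ_apply]
    refine ih ?_
    have hn : p.natDegree = n + (k + 1) := natDegree_eq_of_degree_eq_some hp
    rw [degree_derivative (by omega), hn]
    rfl

open Polynomial in
theorem degree_iterate_derivative_legendrePoly (m i : ℕ) :
    (derivative^[m] (legendrePoly (m + i))).degree = i := by
  have h1 : ((X ^ 2 - 1 : ℝ[X]) ^ (m + i)).degree = (i + m + (m + i) : ℕ) := by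
    have h2 : (X ^ 2 - 1 : ℝ[X]).degree = 2 := by
      simpa using degree_X_pow_sub_C (R := ℝ) (n := 2) (by norm_num) 1
    rw [degree_pow, h2, nsmul_eq_mul]
    norm_cast
    ring_nf
  refine degree_iterate_derivative_of_degree_eq m ?_
  rw [legendrePoly, degree_C_mul (by positivity)]
  exact degree_iterate_derivative_of_degree_eq (m + i) h1

open Polynomial in
/-- The polynomials `P_m^(m), P_(m+1)^(m), …` have degrees `0, 1, …`. -/
noncomputable def legendreDerivSequence (m : ℕ) : Polynomial.Sequence ℝ where
  elems' i := derivative^[m] (legendrePoly (m + i))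
  degree_eq' i := degree_iterate_derivative_legendrePoly m i

/-- The restriction of `L (q(x₂) (x₀ + i x₁) ^ m)` to the sphere. -/
noncomputable def axialMap (L : ℂ →L[ℝ] ℝ) (m : ℕ) : Polynomial ℝ →ₗ[ℝ] C(S2, ℝ) where
  toFun q := ⟨fun s => L (axialFn q m s),
    L.continuous.comp ((contDiff_axialFn q m).continuous.comp continuous_subtype_val)⟩
  map_add' p q := by ext s; simp [axialFn, add_mul]
  map_smul' c q := by ext s; simp [axialFn, ← Complex.real_smul]

theorem axialMap_apply (L : ℂ →L[ℝ] ℝ) (m : ℕ) (q : Polynomial ℝ) (s : S2) :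
    axialMap L m q s = L (((q.eval ((s : E3) 2) : ℝ) : ℂ) * planar s ^ m) := rfl

/-- The spherical harmonic `Y_l^m` as a continuous function. -/
noncomputable def sphericalHarmonicMap (l : ℕ) (m : ℤ) : C(S2, ℝ) where
  toFun := sphericalHarmonic l m
  continuous_toFun := by
    obtain ⟨A, hA, h⟩ := exists_eigenfunction_sphericalHarmonic l m
    rw [← funext h]
    exact hA.contDiff.continuous.comp continuous_subtype_val

/-- The span of all spherical harmonics. -/
noncomputable def harmonicSpan : Submodule ℝ C(S2, ℝ) :=
  Submodule.span ℝ {f | ∃ (l : ℕ) (m : ℤ), m.natAbs ≤ l ∧ f = sphericalHarmonicMap l m}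

theorem sphericalHarmonic_coeff_pos (l m : ℕ) :
    0 < √((2 * l + 1) / (4 * Real.pi) * (((l - m)! : ℝ) / ((l + m)! : ℝ))) := by
  have := Real.pi_pos
  positivity

/-- A sequence with one polynomial of each degree spans ℝ[X], so membership need only be checked on
the m-th derivatives of the Legendre polynomials. -/
theorem axialMap_mem_of_forall {L : ℂ →L[ℝ] ℝ} {m : ℕ}
    (h : ∀ i, axialMap L m (Polynomial.derivative^[m] (legendrePoly (m + i))) ∈ harmonicSpan)
    (q : Polynomial ℝ) : axialMap L m q ∈ harmonicSpan := by
  have hs : Submodule.span ℝ (Set.range (legendreDerivSequence m)) ≤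
      harmonicSpan.comap (axialMap L m) := by
    rw [Submodule.span_le]
    rintro _ ⟨i, rfl⟩
    exact h i
  rw [(legendreDerivSequence m).span fun i =>
    (Polynomial.leadingCoeff_ne_zero.2 ((legendreDerivSequence m).ne_zero i)).isUnit] at hs
  exact hs (Submodule.mem_top (x := q))

theorem axialMap_re_mem (m : ℕ) (q : Polynomial ℝ) :
    axialMap Complex.reCLM m q ∈ harmonicSpan := by
  refine axialMap_mem_of_forall (fun i => ?_) q
  have hc := (sphericalHarmonic_coeff_pos (m + i) m).ne'
  have h2 : (if m = 0 then 1 else √2) ≠ (0 : ℝ) := by split_ifs <;> positivity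
  have : axialMap Complex.reCLM m (Polynomial.derivative^[m] (legendrePoly (m + i))) =
      (√((2 * (m + i : ℕ) + 1) / (4 * Real.pi) *
        (((m + i - m)! : ℝ) / ((m + i + m)! : ℝ))) * if m = 0 then 1 else √2)⁻¹ •
        sphericalHarmonicMap (m + i) m := by
    rw [eq_inv_smul_iff₀ (mul_ne_zero hc h2)]
    ext s
    simp only [ContinuousMap.smul_apply, axialMap_apply, sphericalHarmonicMap,
      ContinuousMap.coe_mk, sphericalHarmonic, azimuthal, Int.natAbs_natCast, planar, smul_eq_mul,
      Complex.reCLM_apply, Complex.re_ofReal_mul, Nat.cast_eq_zero]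
    rcases Nat.eq_zero_or_pos m with rfl | h
    · simp
    · simp [h.ne', h]; ring
  rw [this]
  exact Submodule.smul_mem _ _ (Submodule.subset_span ⟨m + i, m, by simp, rfl⟩)

theorem axialMap_im_mem (m : ℕ) (q : Polynomial ℝ) :
    axialMap Complex.imCLM m q ∈ harmonicSpan := by
  rcases Nat.eq_zero_or_pos m with rfl | h
  · have : axialMap Complex.imCLM 0 q = 0 := by
      ext s; simp [axialMap_apply]
    rw [this]; exact zero_mem _
  refine axialMap_mem_of_forall (fun i => ?_) q
  have hc := (sphericalHarmonic_coeff_pos (m + i) m).ne'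
  have : axialMap Complex.imCLM m (Polynomial.derivative^[m] (legendrePoly (m + i))) =
      (√((2 * (m + i : ℕ) + 1) / (4 * Real.pi) *
        (((m + i - m)! : ℝ) / ((m + i + m)! : ℝ))) * √2)⁻¹ •
        sphericalHarmonicMap (m + i) (-m) := by
    rw [eq_inv_smul_iff₀ (mul_ne_zero hc (by positivity))]
    ext s
    simp only [ContinuousMap.smul_apply, axialMap_apply, sphericalHarmonicMap,
      ContinuousMap.coe_mk, sphericalHarmonic, azimuthal, Int.natAbs_neg, Int.natAbs_natCast,
      planar, smul_eq_mul, Complex.imCLM_apply, Complex.im_ofReal_mul]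
    simp [h.ne', (Int.natCast_nonneg m).not_gt]; ring
  rw [this]
  exact Submodule.smul_mem _ _ (Submodule.subset_span ⟨m + i, -m, by simp, rfl⟩)

theorem axialMap_mem (L : ℂ →L[ℝ] ℝ) (m : ℕ) (q : Polynomial ℝ) :
    axialMap L m q ∈ harmonicSpan := by
  have : axialMap L m q = L 1 • axialMap Complex.reCLM m q
      + L Complex.I • axialMap Complex.imCLM m q := by
    ext s
    simp only [ContinuousMap.add_apply, ContinuousMap.smul_apply, axialMap_apply, smul_eq_mul]
    set z := ((q.eval ((s : E3) 2) : ℝ) : ℂ) * planar s ^ m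
    have hz : z = z.re • (1 : ℂ) + z.im • Complex.I := by
      apply Complex.ext <;> simp
    conv_lhs => rw [hz]
    rw [map_add, map_smul, map_smul, smul_eq_mul, smul_eq_mul]
    simp [mul_comm]
  rw [this]
  exact add_mem (Submodule.smul_mem _ _ (axialMap_re_mem m q))
    (Submodule.smul_mem _ _ (axialMap_im_mem m q))

/-- The coordinate functions on the sphere. -/
noncomputable def coordMap (i : Fin 3) : C(S2, ℝ) where
  toFun s := (s : E3) i
  continuous_toFun := (EuclideanSpace.proj i : E3 →L[ℝ] ℝ).continuous.comp continuous_subtype_val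

theorem coordMap_apply (i : Fin 3) (s : S2) : coordMap i s = (s : E3) i := rfl

theorem sphere_coord_sq (s : S2) : (s : E3) 0 ^ 2 + (s : E3) 1 ^ 2 + (s : E3) 2 ^ 2 = 1 := by
  have := EuclideanSpace.real_norm_sq_eq (s : E3)
  rw [norm_eq_of_mem_sphere, Fin.sum_univ_three] at this
  linarith

/-- The real functional `z ↦ L (c z)`. -/
noncomputable def precompMul (L : ℂ →L[ℝ] ℝ) (c : ℂ) : ℂ →L[ℝ] ℝ :=
  L ∘L (ContinuousLinearMap.mul ℝ ℂ c)

/-- Multiplication by x₂ replaces q by Xq. The other coordinates are combinations of z = x₀ + i x₁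
and its conjugate: z raises the power m, while z z̄ = 1 - x₂² lets z̄ lower it. At m = 0 there is no
power to lower, but x₀ and x₁ are Re z and Im z. -/
theorem coordMap_mul_axialMap_mem (i : Fin 3) (L : ℂ →L[ℝ] ℝ) (m : ℕ) (q : Polynomial ℝ) :
    coordMap i * axialMap L m q ∈ harmonicSpan := by
  have hmul : ∀ (r : ℝ) (z : ℂ), r * L z = L (r * z) := fun r z => by
    rw [← Complex.real_smul, map_smul, smul_eq_mul]
  have hs : ∀ s : S2, ((s : E3) 0 : ℂ) ^ 2 + ((s : E3) 1 : ℂ) ^ 2 =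
      1 - ((s : E3) 2 : ℂ) ^ 2 := fun s => by
    have := sphere_coord_sq s
    have h2 : (((s : E3) 0 ^ 2 + (s : E3) 1 ^ 2 + (s : E3) 2 ^ 2 : ℝ) : ℂ) = 1 := by
      rw [this]; simp
    push_cast at h2
    linear_combination h2
  have h2 : coordMap 2 * axialMap L m q = axialMap L m (Polynomial.X * q) := by
    ext s
    simp only [ContinuousMap.mul_apply, axialMap_apply, coordMap_apply, hmul]
    congr 1
    simp; ring
  have h01 : ∀ (m : ℕ) (c d : ℂ) (i : Fin 3), (∀ s : S2, ((s : E3) i : ℂ) =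
      c * planar s + d * (starRingEnd ℂ) (planar s)) →
      coordMap i * axialMap L (m + 1) q = axialMap (precompMul L c) (m + 2) q +
        axialMap (precompMul L d) m ((1 - Polynomial.X ^ 2) * q) := by
    intro m c d i hi
    ext s
    simp only [ContinuousMap.mul_apply, ContinuousMap.add_apply, axialMap_apply, coordMap_apply,
      hmul, precompMul, ContinuousLinearMap.comp_apply, ← map_add,
      ContinuousLinearMap.mul_apply']
    congr 1
    have hp : planar s * (starRingEnd ℂ) (planar s) = 1 - ((s : E3) 2 : ℂ) ^ 2 := by
      rw [← hs, planar_eq]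
      simp
      linear_combination -((s : E3) 1 : ℂ) ^ 2 * Complex.I_sq
    rw [hi]
    simp only [Polynomial.eval_mul, Polynomial.eval_sub, Polynomial.eval_one, Polynomial.eval_pow,
      Polynomial.eval_X]
    push_cast
    linear_combination d * (q.eval ((s : E3) 2) : ℝ) * planar s ^ m * hp
  have h0 : ∀ s : S2, ((s : E3) 0 : ℂ) =
      (1 / 2) * planar s + (1 / 2) * (starRingEnd ℂ) (planar s) := fun s => by
    rw [planar_eq]; simp; ring
  have h1 : ∀ s : S2, ((s : E3) 1 : ℂ) =
      (-Complex.I / 2) * planar s + (Complex.I / 2) * (starRingEnd ℂ) (planar s) := fun s => by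
    rw [planar_eq]; simp
    linear_combination ((s : E3) 1 : ℂ) * Complex.I_sq
  have hz0 : coordMap 0 * axialMap L 0 q = axialMap (L 1 • Complex.reCLM) 1 q := by
    ext s
    have : L ((q.eval ((s : E3) 2) : ℝ) : ℂ) = q.eval ((s : E3) 2) * L 1 := by
      rw [hmul, mul_one]
    simp [axialMap_apply, coordMap_apply, this, planar]; ring
  have hz1 : coordMap 1 * axialMap L 0 q = axialMap (L 1 • Complex.imCLM) 1 q := by
    ext s
    have : L ((q.eval ((s : E3) 2) : ℝ) : ℂ) = q.eval ((s : E3) 2) * L 1 := by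
      rw [hmul, mul_one]
    simp [axialMap_apply, coordMap_apply, this, planar]; ring
  have hz : ∀ i : Fin 3, (coordMap i * axialMap L 0 q ∈ harmonicSpan) → ∀ c d : ℂ,
      (∀ s : S2, ((s : E3) i : ℂ) = c * planar s + d * (starRingEnd ℂ) (planar s)) →
      coordMap i * axialMap L m q ∈ harmonicSpan := by
    intro i hi c d hcd
    rcases m with _ | m
    · exact hi
    · rw [h01 m c d i hcd]
      exact add_mem (axialMap_mem _ _ _) (axialMap_mem _ _ _)
  fin_cases i
  · exact hz 0 (hz0 ▸ axialMap_mem _ _ _) _ _ h0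
  · exact hz 1 (hz1 ▸ axialMap_mem _ _ _) _ _ h1
  · exact h2 ▸ axialMap_mem _ _ _

theorem coordMap_mul_mem (i : Fin 3) {f : C(S2, ℝ)} (hf : f ∈ harmonicSpan) :
    coordMap i * f ∈ harmonicSpan := by
  have h : harmonicSpan ≤ harmonicSpan.comap (LinearMap.mulLeft ℝ (coordMap i)) := by
    refine Submodule.span_le.2 ?_
    rintro _ ⟨l, m, -, rfl⟩
    obtain ⟨L, h⟩ := exists_sphericalHarmonic_eq l m
    have h' : sphericalHarmonicMap l m =
        axialMap L m.natAbs (Polynomial.derivative^[m.natAbs] (legendrePoly l)) :=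
      ContinuousMap.ext h
    rw [h']
    exact coordMap_mul_axialMap_mem i L _ _
  exact h hf

/-- The span contains 1 and is stable under multiplication by coordinates, hence contains every
polynomial in them. -/
theorem adjoin_coordMap_le :
    Subalgebra.toSubmodule (Algebra.adjoin ℝ (Set.range coordMap)) ≤ harmonicSpan := by
  rw [Algebra.adjoin_eq_span, Submodule.span_le]
  intro f hf
  refine Submonoid.closure_induction_left (motive := fun f _ => f ∈ harmonicSpan) ?_ ?_ hf
  · have : (1 : C(S2, ℝ)) = axialMap Complex.reCLM 0 1 := by
      ext s; simp [axialMap_apply]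
    rw [this]
    exact axialMap_mem _ _ _
  · rintro _ ⟨i, rfl⟩ g _ hg
    exact coordMap_mul_mem i hg

/-- The spherical harmonics span a dense subspace of `C(S²)`. -/
theorem topologicalClosure_harmonicSpan : harmonicSpan.topologicalClosure = ⊤ := by
  have hsep : (Algebra.adjoin ℝ (Set.range coordMap)).SeparatesPoints := by
    intro s t hst
    by_contra! h
    refine hst (Subtype.ext ?_)
    ext i
    exact h _ ⟨coordMap i, Algebra.subset_adjoin ⟨i, rfl⟩, rfl⟩
  refine top_unique fun f _ => ?_
  have hf := ContinuousMap.continuousMap_mem_subalgebra_closure_of_separatesPoints _ hsep f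
  exact Submodule.topologicalClosure_mono adjoin_coordMap_le hf

/-! ### Expansion in L²(S²) -/

/-- Surface measure on the sphere. -/
noncomputable abbrev surfaceMeasure : Measure S2 := (volume : Measure E3).toSphere

/-- A continuous function on the sphere as an element of `L²(S²)`. -/
noncomputable abbrev toL2 : C(S2, ℝ) →L[ℝ] Lp ℝ 2 surfaceMeasure :=
  ContinuousMap.toLp 2 surfaceMeasure ℝ

theorem inner_toL2 (f g : C(S2, ℝ)) :
    inner ℝ (toL2 f) (toL2 g) = ∫ s : S2, f s * g s ∂surfaceMeasure := by
  rw [ContinuousMap.inner_toLp]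
  simp [mul_comm]

/-- Uniform density passes to L² because continuous functions are dense there. -/
theorem eq_zero_of_inner_sphericalHarmonic {g : Lp ℝ 2 surfaceMeasure}
    (h : ∀ (l : ℕ) (m : ℤ), m.natAbs ≤ l → inner ℝ g (toL2 (sphericalHarmonicMap l m)) = 0) :
    g = 0 := by
  have hd := (ContinuousMap.toLp_denseRange ℝ surfaceMeasure ℝ
    (by norm_num : (2 : ENNReal) ≠ ⊤)).topologicalClosure_map_submodule
      topologicalClosure_harmonicSpan
  have hd' : Dense ((harmonicSpan.map toL2.toLinearMap : Submodule ℝ _) : Set (Lp ℝ 2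
      surfaceMeasure)) := Submodule.dense_iff_topologicalClosure_eq_top.2 hd
  refine hd'.eq_zero_of_inner_left ℝ ?_
  rintro _ ⟨f, hf, rfl⟩
  have hle : harmonicSpan ≤ (LinearMap.ker (innerSL ℝ g).toLinearMap).comap toL2.toLinearMap := by
    refine Submodule.span_le.2 ?_
    rintro _ ⟨l, m, hm, rfl⟩
    simpa using h l m hm
  simpa using hle hf

theorem inner_sphericalHarmonic_eq_zero {l l' : ℕ} (hl : l ≠ l') (m m' : ℤ) :
    inner ℝ (toL2 (sphericalHarmonicMap l m)) (toL2 (sphericalHarmonicMap l' m')) = 0 := by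
  obtain ⟨A, hA, hA'⟩ := exists_eigenfunction_sphericalHarmonic l m
  obtain ⟨B, hB, hB'⟩ := exists_eigenfunction_sphericalHarmonic l' m'
  rw [inner_toL2]
  simp only [sphericalHarmonicMap, ContinuousMap.coe_mk, ← hA', ← hB']
  refine hA.integral_mul_eq_zero hB fun h => hl ?_
  have h' : l * (l + 1) = l' * (l' + 1) := by exact_mod_cast h
  nlinarith [lt_trichotomy l l']

/-- A continuous function orthogonal to all spherical harmonics of degree other than `l` is a
linear combination of the spherical harmonics of degree `l`. -/
theorem exists_eq_sum_sphericalHarmonic {f : C(S2, ℝ)} {l : ℕ}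
    (h : ∀ (l' : ℕ) (m : ℤ), l' ≠ l → inner ℝ (toL2 f) (toL2 (sphericalHarmonicMap l' m)) = 0) :
    ∃ a : ℤ → ℝ, ∀ s, f s = ∑ m ∈ Finset.Icc (-(l : ℤ)) l, a m * sphericalHarmonic l m s := by
  set K : Submodule ℝ C(S2, ℝ) :=
    Submodule.span ℝ (sphericalHarmonicMap l '' (Finset.Icc (-(l : ℤ)) l : Finset ℤ)) with hK
  have : FiniteDimensional ℝ K := FiniteDimensional.span_of_finite ℝ
    ((Finset.finite_toSet _).image _)
  set V := K.map toL2.toLinearMap with hV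
  -- The remainder is orthogonal to degree l by projection, and to every other degree because both
  -- terms are.
  have hp : toL2 f - V.starProjection (toL2 f) = 0 := by
    refine eq_zero_of_inner_sphericalHarmonic fun l' m hm => ?_
    by_cases hl : l' = l
    · subst hl
      refine (Submodule.mem_orthogonal' _ _).1
        (Submodule.sub_starProjection_mem_orthogonal (toL2 f)) _ ?_
      exact ⟨_, Submodule.subset_span ⟨m, by simp; omega, rfl⟩, rfl⟩
    · rw [inner_sub_left, h l' m hl, zero_sub, neg_eq_zero]
      obtain ⟨k, hk, hk'⟩ := V.starProjection_apply_mem (toL2 f)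
      rw [← hk']
      have hle : K ≤ (LinearMap.ker
          (innerSL ℝ (toL2 (sphericalHarmonicMap l' m))).toLinearMap).comap toL2.toLinearMap := by
        refine Submodule.span_le.2 ?_
        rintro _ ⟨m', -, rfl⟩
        simpa using inner_sphericalHarmonic_eq_zero hl m m'
      rw [real_inner_comm]
      simpa using hle hk
  obtain ⟨k, hk, hk'⟩ := V.starProjection_apply_mem (toL2 f)
  -- Continuous functions equal almost everywhere agree everywhere, as surface measure charges open
  -- sets.
  have hfk : f = k := ContinuousMap.toLp_injective (p := 2) (𝕜 := ℝ) surfaceMeasure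
    ((sub_eq_zero.1 hp).trans hk'.symm)
  obtain ⟨a, ha⟩ := Submodule.mem_span_image_finset_iff_exists_fun' ℝ |>.1 hk
  refine ⟨a, fun s => ?_⟩
  rw [hfk, ← ha]
  simp [sphericalHarmonicMap]

/-- Classification of homogeneous harmonic functions on `ℝ³ \ {0}`. -/
theorem WeaklyHarmonic.exists_eq_sum_sphericalHarmonic {u : E3 → ℝ} (hW : WeaklyHarmonic u)
    (hu : ∀ x, x ≠ 0 → ContDiffAt ℝ 1 u x) {β : ℝ}
    (hhom : ∀ x, x ≠ 0 → ∀ t : ℝ, 0 < t → u (t • x) = t ^ β • u x)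
    (hne : ∃ s : S2, u s ≠ 0) :
    ∃ l : ℕ, β * (β + 1) = l * (l + 1) ∧ ∃ a : ℤ → ℝ, ∀ s : S2,
      u s = ∑ m ∈ Finset.Icc (-(l : ℤ)) l, a m * sphericalHarmonic l m s := by
  have hs0 : ∀ s : S2, (s : E3) ≠ 0 := fun s => ne_zero_of_mem_unit_sphere s
  let f : C(S2, ℝ) := ⟨fun s => u s, continuous_iff_continuousAt.2 fun s =>
    (hu s (hs0 s)).continuousAt.comp continuous_subtype_val.continuousAt⟩
  have horth : ∀ (l : ℕ) (m : ℤ), β * (β + 1) ≠ l * (l + 1) →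
      inner ℝ (toL2 f) (toL2 (sphericalHarmonicMap l m)) = 0 := by
    intro l m hl
    obtain ⟨A, hA, hA'⟩ := exists_eigenfunction_sphericalHarmonic l m
    rw [inner_toL2]
    simp only [sphericalHarmonicMap, ContinuousMap.coe_mk, ← hA', f]
    exact hW.integral_sphere_mul_eigenfunction hu hhom hA hl
  by_cases hl : ∃ l : ℕ, β * (β + 1) = l * (l + 1)
  · obtain ⟨l, hl⟩ := hl
    refine ⟨l, hl, _root_.exists_eq_sum_sphericalHarmonic (f := f) fun l' m hl' => horth l' m ?_⟩
    rw [hl]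
    intro h
    have h' : l * (l + 1) = l' * (l' + 1) := by exact_mod_cast h
    exact hl' (by nlinarith [lt_trichotomy l l'])
  · push Not at hl
    have h0 : toL2 f = 0 := eq_zero_of_inner_sphericalHarmonic fun l m _ => horth l m (hl l)
    obtain ⟨s, hs⟩ := hne
    have hf : f = 0 := ContinuousMap.toLp_injective (p := 2) (𝕜 := ℝ) surfaceMeasure
      (h0.trans (map_zero toL2).symm)
    exact absurd (DFunLike.congr_fun hf s) hs

/-! ### Homogeneous extensions -/

theorem homExt_apply {F : Type*} [AddCommGroup F] [Module ℝ F] (β : ℝ) (g : S2 → F) {x : E3}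
    (hx : x ≠ 0) : homExt β g x = (‖x‖ ^ (-β)) • g (unitDir x hx) := by
  simp [homExt, hx]

theorem homExt_coe {F : Type*} [AddCommGroup F] [Module ℝ F] (β : ℝ) (g : S2 → F) (s : S2) :
    homExt β g s = g s := by
  rw [homExt_apply β g (ne_zero_of_mem_unit_sphere s)]
  have : unitDir s (ne_zero_of_mem_unit_sphere s) = s := by
    ext1; simp [unitDir]
  simp [this]

theorem homExt_smul {F : Type*} [AddCommGroup F] [Module ℝ F] (β : ℝ) (g : S2 → F) {x : E3}
    (hx : x ≠ 0) {t : ℝ} (ht : 0 < t) : homExt β g (t • x) = t ^ (-β) • homExt β g x := by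
  rw [homExt_apply β g hx, homExt_apply β g (smul_ne_zero ht.ne' hx), smul_smul,
    ← Real.mul_rpow ht.le (norm_nonneg x)]
  have : unitDir (t • x) (smul_ne_zero ht.ne' hx) = unitDir x hx := by
    ext1
    simp only [unitDir, norm_smul, Real.norm_of_nonneg ht.le, smul_smul]
    congr 1
    field_simp
  rw [this, norm_smul, Real.norm_of_nonneg ht.le]

theorem contMDiff_codRestrict_sphere {n : ℕ∞ω} {N : E3 → E3} (hN : ContDiff ℝ n N)
    (h : ∀ x, N x ∈ Metric.sphere (0 : E3) 1) :
    ContMDiff 𝓘(ℝ, E3) (𝓡 2) n (Set.codRestrict N (Metric.sphere (0 : E3) 1) h : E3 → S2) := by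
  have : Fact (Module.finrank ℝ E3 = 2 + 1) := ⟨finrank_euclideanSpace_fin⟩
  exact hN.contMDiff.codRestrict_sphere h

theorem contMDiff_coe_S2 {n : ℕ∞ω} : ContMDiff (𝓡 2) 𝓘(ℝ, E3) n (fun s : S2 => (s : E3)) := by
  have : Fact (Module.finrank ℝ E3 = 2 + 1) := ⟨finrank_euclideanSpace_fin⟩
  exact contMDiff_coe_sphere

/-- To compose with g, a globally smooth map into the sphere is needed. The bump ρ replaces the
identity by a map Y that equals it near x and stays within |x|/2 of x, hence never vanishes. -/
theorem contDiffAt_homExt {F : Type*} [NormedAddCommGroup F] [NormedSpace ℝ F] {n : ℕ∞}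
    (β : ℝ) {g : S2 → F} (hg : ContMDiff (𝓡 2) 𝓘(ℝ, F) n g) {x : E3} (hx : x ≠ 0) :
    ContDiffAt ℝ n (homExt β g) x := by
  have hpos : 0 < ‖x‖ := by positivity
  let ρ : ContDiffBump x := ⟨‖x‖ / 4, ‖x‖ / 2, by positivity, by linarith⟩
  let Y : E3 → E3 := fun y => x + ρ y • (y - x)
  have hY : ContDiff ℝ n Y := contDiff_const.add (ρ.contDiff.smul (contDiff_id.sub contDiff_const))
  have hY0 : ∀ y, Y y ≠ 0 := by
    intro y h0
    have h1 : ‖ρ y • (y - x)‖ < ‖x‖ := by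
      rw [norm_smul, Real.norm_of_nonneg ρ.nonneg]
      by_cases hy : dist y x < ‖x‖ / 2
      · rw [dist_eq_norm] at hy
        have := mul_le_mul_of_nonneg_right (ρ.le_one (x := y)) (norm_nonneg (y - x))
        linarith
      · rw [ρ.zero_of_le_dist (not_lt.1 hy)]
        simpa using hpos
    have h2 : x = -(ρ y • (y - x)) := eq_neg_of_add_eq_zero_left h0
    have h3 := congrArg norm h2
    rw [norm_neg] at h3
    exact h1.ne h3.symm
  have hYe : ∀ᶠ y in nhds x, Y y = y := by
    filter_upwards [ρ.eventuallyEq_one] with y hy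
    simp [Y, hy]
  have hN : ContDiff ℝ n (fun y => radialProj (Y y)) := contDiff_iff_contDiffAt.2 fun y =>
    (contDiffAt_radialProj (hY0 y)).comp y hY.contDiffAt
  have hS := contMDiff_codRestrict_sphere hN
    fun y => by simpa using norm_radialProj (hY0 y)
  have hgS := (hg.comp hS).contDiff.contDiffAt (x := x)
  have hr : ContDiffAt ℝ n (fun y : E3 => ‖y‖ ^ (-β)) x :=
    (contDiffAt_norm ℝ hx).rpow_const_of_ne hpos.ne'
  refine (hr.smul hgS).congr_of_eventuallyEq ?_
  filter_upwards [hYe, isOpen_ne.mem_nhds hx] with y hy hy0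
  rw [homExt_apply β g hy0]
  congr 2
  ext1
  simp [unitDir, radialProj, hy]

/-! ### Irrotational solenoidal fields -/

/-- A `C¹` vector field on `ℝ³ \ {0}` whose divergence and curl vanish. -/
structure IsHarmonicField (V : E3 → E3) : Prop where
  contDiffAt : ∀ x, x ≠ 0 → ContDiffAt ℝ 1 V x
  divergence_eq_zero : ∀ x, x ≠ 0 → divergence V x = 0
  curl_eq_zero : ∀ x, x ≠ 0 → curl V x = 0

namespace IsHarmonicField

variable {V : E3 → E3}

theorem pderivComp_comm (h : IsHarmonicField V) {x : E3} (hx : x ≠ 0) (i j : Fin 3) :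
    pderivComp V i j x = pderivComp V j i x := by
  have hc := h.curl_eq_zero x hx
  have h0 := congrArg (fun y : E3 => y 0) hc
  have h1 := congrArg (fun y : E3 => y 1) hc
  have h2 := congrArg (fun y : E3 => y 2) hc
  simp [curl] at h0 h1 h2
  fin_cases i <;> fin_cases j <;> simp <;> linarith

theorem inner_fderiv_comm (h : IsHarmonicField V) {x : E3} (hx : x ≠ 0) (a b : E3) :
    inner ℝ (fderiv ℝ V x a) b = inner ℝ (fderiv ℝ V x b) a := by
  have hexp : ∀ a b : E3, inner ℝ (fderiv ℝ V x a) b =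
      ∑ i, ∑ j, a i * b j * pderivComp V i j x := by
    intro a b
    rw [clm_apply_eq_sum _ a]
    simp only [PiLp.inner_apply, pderivComp, Fin.sum_univ_three]
    simp
    ring
  rw [hexp, hexp, Finset.sum_comm]
  refine Finset.sum_congr rfl fun j _ => Finset.sum_congr rfl fun i _ => ?_
  rw [h.pderivComp_comm hx]; ring

/-- The gradient of V·x is V + (DV)ᵀx; symmetry replaces (DV)ᵀx by (DV)x, which is -αV by Euler's
relation. -/
theorem fderiv_inner_self_apply (h : IsHarmonicField V) {α : ℝ}
    (hhom : ∀ x, x ≠ 0 → ∀ t : ℝ, 0 < t → V (t • x) = t ^ (-α) • V x) {x : E3} (hx : x ≠ 0)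
    (y : E3) : fderiv ℝ (fun x => inner ℝ (V x) x) x y = (1 - α) * inner ℝ (V x) y := by
  have hd := (h.contDiffAt x hx).differentiableAt (by simp)
  rw [fderiv_inner_apply ℝ hd differentiableAt_fun_id, fderiv_fun_id, ContinuousLinearMap.id_apply,
    h.inner_fderiv_comm hx, fderiv_apply_self_of_homogeneous hd (hhom x hx), inner_smul_left]
  simp; ring

theorem weaklyHarmonic_inner_self (h : IsHarmonicField V) {α : ℝ}
    (hhom : ∀ x, x ≠ 0 → ∀ t : ℝ, 0 < t → V (t • x) = t ^ (-α) • V x) :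
    WeaklyHarmonic fun x => inner ℝ (V x) x := by
  intro η hη
  have h1 := integral_fderiv_add_mul_divergence (hη.mono (by simp)) h.contDiffAt
  have h2 : ∫ x, ∑ j, fderiv ℝ (fun x => inner ℝ (V x) x) x (EuclideanSpace.single j 1) *
      fderiv ℝ η x (EuclideanSpace.single j 1) =
      (1 - α) * ∫ x, (fderiv ℝ η x (V x) + η x * divergence V x) := by
    rw [← integral_const_mul]
    refine integral_congr_ae ?_
    filter_upwards [ae_ne_zero] with x hx
    rw [h.divergence_eq_zero x hx, clm_apply_eq_sum (fderiv ℝ η x) (V x), mul_zero, add_zero,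
      Finset.mul_sum]
    refine Finset.sum_congr rfl fun j _ => ?_
    rw [h.fderiv_inner_self_apply hhom hx]
    simp [EuclideanSpace.inner_single_right]; ring
  rw [h2, h1, mul_zero]

/-- Serves the case α = 1. Since ∂ⱼVᵢ = ∂ᵢVⱼ, the integrand equals ∑ⱼ ∂ᵢ(Vⱼ ∂ⱼη) - V·∇(∂ᵢη); the
first part integrates to zero directly, the second because div V = 0. No second derivative of V
occurs. -/
theorem weaklyHarmonic_apply (h : IsHarmonicField V) (i : Fin 3) :
    WeaklyHarmonic fun x => V x i := by
  intro η hη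
  set e : Fin 3 → E3 := fun j => EuclideanSpace.single j 1 with he
  have hVj : ∀ (j : Fin 3) x, x ≠ 0 → ContDiffAt ℝ 1 (fun x => V x j) x := fun j x hx =>
    (contDiffAt_piLp_apply 2).comp x (h.contDiffAt x hx)
  have hdj : ∀ (j : Fin 3) x, x ≠ 0 → ∀ y, fderiv ℝ (fun x => V x j) x y = fderiv ℝ V x y j := by
    intro j x hx y
    have h1 := (EuclideanSpace.proj j : E3 →L[ℝ] ℝ).hasFDerivAt.comp x
      ((h.contDiffAt x hx).differentiableAt (by simp)).hasFDerivAt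
    have h2 : HasFDerivAt (fun x => V x j) _ x := h1
    rw [h2.fderiv]; rfl
  have hηj : ∀ j, IsTestFunction ∞ (fun x => fderiv ℝ η x (e j)) := fun j =>
    hη.fderiv_apply (Y := fun _ => e j) contDiff_const
  have hg : ∀ j, IsTestFunction 1 (fun x => V x j * fderiv ℝ η x (e j)) := fun j =>
    ((hηj j).mono (by simp)).mul (hVj j)
  have hgi : ∀ j, Integrable
      (fun x => fderiv ℝ (fun x => V x j * fderiv ℝ η x (e j)) x (e i)) := fun j =>
    (hg j).integrable_fderiv_apply fun _ _ => continuousAt_const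
  have hz1 : ∫ x, ∑ j, fderiv ℝ (fun x => V x j * fderiv ℝ η x (e j)) x (e i) = 0 := by
    rw [integral_finsetSum _ fun j _ => hgi j]
    exact Finset.sum_eq_zero fun j _ =>
      integral_fderiv_apply_const (hg j).contDiff (hg j).hasCompactSupport _
  have hi2 : Integrable (fun x => fderiv ℝ (fun x => fderiv ℝ η x (e i)) x (V x)) :=
    ((hηj i).mono (by simp)).integrable_fderiv_apply fun x hx => (h.contDiffAt x hx).continuousAt
  have hz2 : ∫ x, fderiv ℝ (fun x => fderiv ℝ η x (e i)) x (V x) = 0 := by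
    rw [← integral_fderiv_add_mul_divergence ((hηj i).mono (by simp)) h.contDiffAt]
    refine integral_congr_ae ?_
    filter_upwards [ae_ne_zero] with x hx
    rw [h.divergence_eq_zero x hx, mul_zero, add_zero]
  have hz : ∫ x, ((∑ j, fderiv ℝ (fun x => V x j * fderiv ℝ η x (e j)) x (e i)) -
      fderiv ℝ (fun x => fderiv ℝ η x (e i)) x (V x)) = 0 := by
    rw [integral_sub (integrable_finsetSum _ fun j _ => hgi j) hi2, hz1, hz2, sub_zero]
  rw [← hz]
  refine integral_congr_ae ?_
  filter_upwards [ae_ne_zero] with x hx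
  rw [clm_apply_eq_sum _ (V x), ← Finset.sum_sub_distrib]
  refine Finset.sum_congr rfl fun j _ => ?_
  have hdd : DifferentiableAt ℝ (fderiv ℝ η) x :=
    (hη.contDiff.fderiv_right (m := ∞) (by simp)).differentiable (by simp) x
  have hsnd : ∀ a b, fderiv ℝ (fun x => fderiv ℝ η x a) x b = fderiv ℝ (fderiv ℝ η) x b a := by
    intro a b
    rw [fderiv_clm_apply hdd (differentiableAt_const a)]
    simp
  have hsymm : fderiv ℝ (fderiv ℝ η) x (e i) (e j) = fderiv ℝ (fderiv ℝ η) x (e j) (e i) :=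
    (hη.contDiff.contDiffAt.isSymmSndFDerivAt (by
    rw [minSmoothness_of_isRCLikeNormedField]
    exact WithTop.coe_le_coe.2 (le_top : (2 : ℕ∞) ≤ ⊤))).eq _ _
  rw [fderiv_fun_mul ((hVj j x hx).differentiableAt (by simp))
    ((hηj j).contDiff.differentiable (by simp) x)]
  have hp := h.pderivComp_comm hx j i
  simp only [pderivComp] at hp
  simp only [add_apply, smul_apply, smul_eq_mul, hsnd, hdj i x hx, hdj j x hx, hsymm]
  simp only [he] at hp ⊢
  rw [hp]
  ring

end IsHarmonicField

theorem sphericalHarmonic_zero_zero (s t : S2) :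
    sphericalHarmonic 0 0 s = sphericalHarmonic 0 0 t := by
  simp [sphericalHarmonic, azimuthal, legendrePoly]

/-- A harmonic field homogeneous of degree `-1` vanishes. -/
theorem IsHarmonicField.eq_zero_of_homogeneous {V : E3 → E3} (h : IsHarmonicField V)
    (hhom : ∀ x, x ≠ 0 → ∀ t : ℝ, 0 < t → V (t • x) = t ^ (-1 : ℝ) • V x) {x : E3} (hx : x ≠ 0) :
    V x = 0 := by
  have hc : ∀ i : Fin 3, ∃ c : ℝ, ∀ s : S2, V s i = c := by
    intro i
    by_cases hne : ∃ s : S2, V s i ≠ 0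
    · obtain ⟨l, hl, a, ha⟩ := (h.weaklyHarmonic_apply i).exists_eq_sum_sphericalHarmonic
        -- For β = -1 the condition l(l + 1) = β(β + 1) = 0 leaves only constants.
        (fun x hx => (contDiffAt_piLp_apply 2).comp x (h.contDiffAt x hx)) (β := -1)
        (fun x hx t ht => by rw [hhom x hx t ht]; rfl) hne
      have hl0 : l = 0 := by
        have : (l : ℝ) * (l + 1) = 0 := by rw [← hl]; norm_num
        rcases mul_eq_zero.1 this with h | h
        · exact_mod_cast h
        · exact absurd h (by positivity)
      subst hl0
      obtain ⟨s₀, -⟩ := hne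
      refine ⟨a 0 * sphericalHarmonic 0 0 s₀, fun s => ?_⟩
      rw [ha s, sphericalHarmonic_zero_zero s₀ s]
      simp
    · push Not at hne
      exact ⟨0, hne⟩
  choose c hc using hc
  set C : E3 := WithLp.toLp 2 c with hC
  have hV : ∀ y : E3, y ≠ 0 → V y = ‖y‖⁻¹ • C := by
    intro y hy
    rw [homogeneous_eq_radialProj hhom hy, Real.rpow_neg_one]
    congr 1
    ext i
    exact hc i ⟨radialProj y, by simpa using norm_radialProj hy⟩
  suffices C = 0 by rw [hV x hx, this, smul_zero]
  by_contra hC0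
  -- The divergence of C/|y| is -C·y/|y|³, which at y = C equals -1/|C|.
  have hdiv := h.divergence_eq_zero C hC0
  have hd : HasFDerivAt V ((-(‖C‖ ^ 2)⁻¹ • (‖C‖⁻¹ • innerSL ℝ C)).smulRight C) C := by
    have h1 := ((hasDerivAt_inv (norm_ne_zero_iff.2 hC0)).comp_hasFDerivAt C
      (hasFDerivAt_norm hC0)).smul_const C
    refine h1.congr_of_eventuallyEq ?_
    filter_upwards [isOpen_ne.mem_nhds hC0] with y hy
    exact hV y hy
  have hn : 0 < ‖C‖ := norm_pos_iff.2 hC0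
  have hsum : divergence V C = -(‖C‖ ^ 2)⁻¹ * ‖C‖⁻¹ * ‖C‖ ^ 2 := by
    rw [EuclideanSpace.real_norm_sq_eq C]
    simp only [divergence, pderivComp, hd.fderiv, Finset.mul_sum]
    refine Finset.sum_congr rfl fun i _ => ?_
    simp [EuclideanSpace.inner_single_right, EuclideanSpace.real_norm_sq_eq]
    ring
  rw [hsum] at hdiv
  have : (‖C‖ ^ 2)⁻¹ * ‖C‖⁻¹ * ‖C‖ ^ 2 ≠ 0 := by positivity
  apply this
  linarith

/-! ### Irrotational homogeneous Euler flows -/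

section Euler

variable {α : ℝ} {v : S2 → E3} {f p : S2 → ℝ}

theorem velocity_coe (α : ℝ) (v : S2 → E3) (f : S2 → ℝ) (s : S2) :
    velocity α v f s = v s + f s • (s : E3) :=
  homExt_coe _ _ _

theorem velocity_smul (α : ℝ) (v : S2 → E3) (f : S2 → ℝ) {x : E3} (hx : x ≠ 0) {t : ℝ}
    (ht : 0 < t) : velocity α v f (t • x) = t ^ (-α) • velocity α v f x :=
  homExt_smul _ _ hx ht

namespace IsHomogeneousEulerSolution

theorem isHarmonicField (h : IsHomogeneousEulerSolution α v f p)
    (hirr : ∀ x : E3, x ≠ 0 → curl (velocity α v f) x = 0) :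
    IsHarmonicField (velocity α v f) where
  contDiffAt _ hx := contDiffAt_homExt (n := 1) α
    (h.contMDiff_v.add (h.contMDiff_f.smul contMDiff_coe_S2)) hx
  divergence_eq_zero := h.incompressible
  curl_eq_zero := hirr

theorem inner_velocity_coe (h : IsHomogeneousEulerSolution α v f p) (s : S2) :
    inner ℝ (velocity α v f s) (s : E3) = f s := by
  rw [velocity_coe, inner_add_left, h.tangent, inner_smul_left, real_inner_self_eq_norm_sq,
    norm_eq_of_mem_sphere]
  simp

theorem norm_velocity_coe_sq (h : IsHomogeneousEulerSolution α v f p) (s : S2) :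
    ‖velocity α v f s‖ ^ 2 = ‖v s‖ ^ 2 + f s ^ 2 := by
  rw [velocity_coe, norm_add_sq_real, inner_smul_right, h.tangent, norm_smul,
    norm_eq_of_mem_sphere]
  simp

theorem inner_velocity_smul (α : ℝ) (v : S2 → E3) (f : S2 → ℝ) {x : E3} (hx : x ≠ 0) {t : ℝ}
    (ht : 0 < t) : inner ℝ (velocity α v f (t • x)) (t • x) =
      t ^ (1 - α) • inner ℝ (velocity α v f x) x := by
  rw [velocity_smul α v f hx ht, inner_smul_left, inner_smul_right, sub_eq_add_neg,
    Real.rpow_add ht, Real.rpow_one]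
  simp; ring

/-- Away from the origin the degree-zero extension of f is |x|^(α-1) (V·x). Its gradient at s is (α
- 1)f s + (1 - α)(v + f s), where the radial parts cancel. -/
theorem smul_eq_sphereGradient (h : IsHomogeneousEulerSolution α v f p)
    (hirr : ∀ x : E3, x ≠ 0 → curl (velocity α v f) x = 0) (s : S2) :
    (1 - α) • v s = sphereGradient f s := by
  have hF := h.isHarmonicField hirr
  have hs : (s : E3) ≠ 0 := ne_zero_of_mem_unit_sphere s
  have hsn : ‖(s : E3)‖ = 1 := norm_eq_of_mem_sphere s
  have hφd : DifferentiableAt ℝ (fun x => inner ℝ (velocity α v f x) x) (s : E3) :=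
    ((hF.contDiffAt s hs).differentiableAt (by simp)).inner ℝ differentiableAt_fun_id
  have hr : HasFDerivAt (fun x : E3 => ‖x‖ ^ (α - 1)) _ (s : E3) :=
    (Real.hasDerivAt_rpow_const (p := α - 1)
      (Or.inl (norm_ne_zero_iff.2 hs))).comp_hasFDerivAt (s : E3) (hasFDerivAt_norm hs)
  have hm := hr.fun_mul hφd.hasFDerivAt
  have heq : homExt 0 f =ᶠ[nhds (s : E3)]
      fun x => ‖x‖ ^ (α - 1) * inner ℝ (velocity α v f x) x := by
    filter_upwards [isOpen_ne.mem_nhds hs] with x hx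
    have hpos : 0 < ‖x‖ := norm_pos_iff.2 hx
    have h1 := homogeneous_eq_radialProj (u := fun x => inner ℝ (velocity α v f x) x)
      (fun x hx t ht => inner_velocity_smul α v f hx ht) hx
    have h2 := h.inner_velocity_coe (unitDir x hx)
    rw [h1, homExt_apply 0 f hx, ← h2, smul_eq_mul, smul_eq_mul, ← mul_assoc,
      ← Real.rpow_add hpos]
    simp [unitDir, radialProj]
  have hg : HasGradientAt (homExt 0 f) ((1 - α) • v s) (s : E3) := by
    rw [hasGradientAt_iff_hasFDerivAt]
    refine (hm.congr_of_eventuallyEq heq).congr_fderiv ?_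
    ext y
    simp only [add_apply, smul_apply, smul_eq_mul, hF.fderiv_inner_self_apply
      (fun x hx t ht => velocity_smul α v f hx ht) hs, h.inner_velocity_coe, hsn,
      InnerProductSpace.toDual_apply_apply, innerSL_apply_apply, Real.one_rpow]
    rw [velocity_coe, inner_add_left, inner_smul_left, inner_smul_left]
    simp
    ring
  exact hg.gradient.symm

/-- Symmetry of DV makes the momentum equation say that |V|² + 2P has zero gradient, and ℝ³ minus a
point is connected. -/
theorem exists_bernoulli_const (h : IsHomogeneousEulerSolution α v f p)
    (hirr : ∀ x : E3, x ≠ 0 → curl (velocity α v f) x = 0) :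
    ∃ c : ℝ, (α ≠ 0 → c = 0) ∧ ∀ s : S2, bernoulliFn v f p s = 2 * c := by
  have hF := h.isHarmonicField hirr
  set V := velocity α v f with hV
  have hVd : ∀ x, x ≠ 0 → DifferentiableAt ℝ V x := fun x hx =>
    (hF.contDiffAt x hx).differentiableAt (by simp)
  have hPd : ∀ x, x ≠ 0 → DifferentiableAt ℝ (pressure α p) x := fun x hx =>
    (contDiffAt_homExt (n := 1) (2 * α) h.contMDiff_p hx).differentiableAt (by simp)
  let B : E3 → ℝ := fun x => ‖V x‖ ^ 2 + 2 * pressure α p x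
  have hB : ∀ x, x ≠ 0 → HasFDerivAt B (0 : E3 →L[ℝ] ℝ) x := by
    intro x hx
    have h1 := (hVd x hx).hasFDerivAt.norm_sq.fun_add ((hPd x hx).hasFDerivAt.const_mul 2)
    refine h1.congr_fderiv ?_
    ext y
    have h2 := congrArg (fun z : E3 => (inner ℝ z y : ℝ)) (h.momentum x hx)
    simp only [inner_add_left, inner_zero_left] at h2
    have h3 : inner ℝ (gradient (pressure α p) x) y = fderiv ℝ (pressure α p) x y := by
      simp [gradient]
    rw [h3, ← hV, hF.inner_fderiv_comm hx, real_inner_comm] at h2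
    simp
    linarith
  obtain ⟨c, hc⟩ := isOpen_compl_singleton.exists_is_const_of_fderiv_eq_zero (𝕜 := ℝ) (f := B)
    (s := {(0 : E3)}ᶜ)
    (isConnected_compl_singleton_of_one_lt_rank
      (by rw [← Module.finrank_eq_rank]; simp) (0 : E3)).isPreconnected
    (fun x hx => (hB x hx).differentiableAt.differentiableWithinAt)
    (fun x hx => (hB x hx).fderiv)
  have hs : ∀ s : S2, bernoulliFn v f p s = c := fun s => by
    rw [← hc (s : E3) (ne_zero_of_mem_unit_sphere s)]
    simp only [B, bernoulliFn, hV, h.norm_velocity_coe_sq, pressure, homExt_coe]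
  refine ⟨c / 2, fun hα => ?_, fun s => by rw [hs]; ring⟩
  -- Comparing a unit vector e with 2e gives c = 2^(-2α) c by homogeneity.
  have he : EuclideanSpace.single (0 : Fin 3) (1 : ℝ) ≠ 0 := by simp
  have h1 := hc _ he
  have h2 := hc ((2 : ℝ) • EuclideanSpace.single (0 : Fin 3) (1 : ℝ)) (by simp)
  simp only [B, hV, velocity_smul α v f he two_pos, pressure,
    homExt_smul (2 * α) p he two_pos, norm_smul, smul_eq_mul] at h1 h2
  have h3 : ‖(2 : ℝ) ^ (-α)‖ ^ 2 = 2 ^ (-(2 * α)) := by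
    rw [Real.norm_of_nonneg (by positivity), ← Real.rpow_natCast, ← Real.rpow_mul (by norm_num)]
    congr 1; push_cast; ring
  rw [mul_pow, h3] at h2
  have h4 : ((2 : ℝ) ^ (-(2 * α)) - 1) * c = 0 := by
    rw [← h1]; linear_combination h2 - h1
  rcases mul_eq_zero.1 h4 with h5 | h5
  · exfalso
    have h6 : (2 : ℝ) ^ (-(2 * α)) = 2 ^ (0 : ℝ) := by simp; linarith
    have := (Real.rpow_right_inj (by norm_num) (by norm_num)).1 h6
    exact hα (by linarith)
  · rw [h5]; simp

theorem ne_one (h : IsHomogeneousEulerSolution α v f p) (hne : ∃ s : S2, v s ≠ 0 ∨ f s ≠ 0)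
    (hirr : ∀ x : E3, x ≠ 0 → curl (velocity α v f) x = 0) : α ≠ 1 := by
  rintro rfl
  obtain ⟨s, hs⟩ := hne
  have h0 := (h.isHarmonicField hirr).eq_zero_of_homogeneous
    (fun x hx t ht => velocity_smul 1 v f hx ht) (ne_zero_of_mem_unit_sphere s)
  have hn := h.norm_velocity_coe_sq s
  rw [h0] at hn
  have hf : f s = 0 := by
    have := h.inner_velocity_coe s
    rw [h0] at this
    simpa using this.symm
  rw [hf] at hn
  simp at hn
  exact hs.elim (fun h => h (norm_eq_zero.1 (by simpa using hn.symm))) fun h => h hf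

end IsHomogeneousEulerSolution

end Euler

theorem mainTheorem2 (α : ℝ) (v : S2 → E3) (f p : S2 → ℝ)
    (hsol : IsHomogeneousEulerSolution α v f p)
    (hne : ∃ s : S2, v s ≠ 0 ∨ f s ≠ 0)
    (hirr : ∀ x : E3, x ≠ 0 → curl (velocity α v f) x = 0) :
    ∃ k : ℤ, α = k ∧ k ≠ 1 ∧
      (∀ s : S2, (1 - α) • v s = sphereGradient f s) ∧
      (∃ c : ℝ, (α ≠ 0 → c = 0) ∧
        (∀ s : S2, p s = -(1 / 2) * f s ^ 2
          - 1 / (2 * (1 - α) ^ 2) * ‖sphereGradient f s‖ ^ 2 + c) ∧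
        (∀ s : S2, bernoulliFn v f p s = 2 * c)) ∧
      (∃ l : ℕ, ((k ≤ 0 ∧ (l : ℤ) = 1 - k) ∨ (2 ≤ k ∧ (l : ℤ) = k - 2)) ∧
        ∃ a : ℤ → ℝ, ∀ s : S2,
          f s = ∑ m ∈ Finset.Icc (-(l : ℤ)) (l : ℤ), a m * sphericalHarmonic l m s) := by
  have hα : α ≠ 1 := hsol.ne_one hne hirr
  have hα' : 1 - α ≠ 0 := sub_ne_zero.2 hα.symm
  have hgrad := hsol.smul_eq_sphereGradient hirr
  have hF := hsol.isHarmonicField hirr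
  -- If f vanished identically, (1 - α)v = ∇f would force v = 0 as well.
  have hfne : ∃ s : S2, f s ≠ 0 := by
    by_contra! h0
    obtain ⟨s, hs⟩ := hne
    refine hs.elim (fun hv => hv ?_) fun hf => hf (h0 s)
    have hz : homExt 0 f = fun _ => 0 := by
      ext x
      rcases eq_or_ne x 0 with rfl | hx
      · simp [homExt]
      · simp [homExt_apply 0 f hx, h0]
    have := hgrad s
    rw [sphereGradient, hz] at this
    simpa [gradient, hα'] using this
  obtain ⟨l, hl, a, ha⟩ := (hF.weaklyHarmonic_inner_self
    fun x hx t ht => velocity_smul α v f hx ht).exists_eq_sum_sphericalHarmonic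
    (fun x hx => (hF.contDiffAt x hx).inner ℝ contDiffAt_id) (β := 1 - α)
    (fun x hx t ht => IsHomogeneousEulerSolution.inner_velocity_smul α v f hx ht)
    (by simpa only [hsol.inner_velocity_coe] using hfne)
  simp only [hsol.inner_velocity_coe] at ha
  have hbern : ∃ c : ℝ, (α ≠ 0 → c = 0) ∧
      (∀ s : S2, p s = -(1 / 2) * f s ^ 2
        - 1 / (2 * (1 - α) ^ 2) * ‖sphereGradient f s‖ ^ 2 + c) ∧
      (∀ s : S2, bernoulliFn v f p s = 2 * c) := by
    obtain ⟨c, hc0, hc⟩ := hsol.exists_bernoulli_const hirr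
    refine ⟨c, hc0, fun s => ?_, hc⟩
    have h1 := hc s
    rw [bernoulliFn] at h1
    rw [← hgrad s, norm_smul, mul_pow, Real.norm_eq_abs, sq_abs]
    field_simp
    linarith
  -- Factorization of β(β + 1) = l(l + 1) with β = 1 - α. On the first root, l = 0 would mean α = 1,
  -- so l ≥ 1 and k ≤ 0.
  have hk : (1 - α - l) * (2 - α + l) = 0 := by linear_combination hl
  rcases mul_eq_zero.1 hk with h | h
  · refine ⟨1 - l, by push_cast; linarith, ?_, hgrad, hbern, l, Or.inl ⟨?_, by ring⟩, a, ha⟩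
    all_goals
      have hl0 : l ≠ 0 := by
        rintro rfl
        exact hα' (by simpa using h)
      omega
  · exact ⟨l + 2, by push_cast; linarith, by omega, hgrad, hbern, l, Or.inr ⟨by omega, by ring⟩,
      a, ha⟩
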